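/- Let $g\ge 0$ and let $-1<\alpha_1<\beta_1<\alpha_2<\beta_2<\dots<\alpha_g<\beta_g<1$. Put $$E=[-1,\alpha_1]\cup[\beta_1,\alpha_2]\cup\dots\cup[\beta_{g-1},\alpha_g]\cup[\beta_g,1]$$ (so $E=[-1,1]$ if $g=0$), a union of $g+1$ disjoint subintervals, and on $E$ consider the weight $$w(x)=\frac1\pi\sqrt{\frac{\prod_{j=1}^g(x-\alpha_j)}{(1-x^2)\prod_{j=1}^g(x-\beta_j)}}.$$ Let $P_n$ ($n\ge 0$) be the monic polynomials, $\deg P_n=n$, with $\int_E P_nP_m\,w\,dx=h_n\delta_{nm}$ (the generalized Chebyshev polynomials on $E$), and let $a_n,b_n$ ($n\ge1$) be the coefficients of their recurrence relation $$xP_n(x)=P_{n+1}(x)+b_{n+1}P_n(x)+a_nP_{n-1}(x)\qquad(n\ge 0,\ P_{-1}=0).$$ Suppose that the recurrence coefficients have period $\mathfrak K\ge 1$, that is, $b_{n+\mathfrak K}=b_n$ for all $n\ge 1$ and $a_{n+\mathfrak K}=a_n$ for all $n\ge 2$ ($\mathfrak K$ need not be the smallest period). Put $\Delta_{\mathfrak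 K}=\sqrt{2h_{\mathfrak K}}>0$ and $M_{\mathfrak K}(x)=P_{\mathfrak K}(x)/\Delta_{\mathfrak K}$. Then: 1. $M_{\mathfrak K}$ maps each of the $g+1$ subintervals of $E$ onto $[-1,1]$. 2. $E$ is the full preimage of $[-1,1]$: $\{x\in\mathbb R: M_{\mathfrak K}(x)\in[-1,1]\}=E$, and also $\{z\in\mathbb C: M_{\mathfrak K}(z)\in[-1,1]\}=E$. 3. For every $n\ge 0$, $T_n(M_{\mathfrak K}(x))=\Delta_{\mathfrak K}^{-n}P_{n\mathfrak K}(x)$, where $T_n$ is the monic Chebyshev polynomial of the first kind of degree $n$; in particular $T_n(M_{\mathfrak K})$ is proportional to $P_{n\mathfrak K}$. 4. $E$ has at most $\mathfrak K$ subintervals: $g\le\mathfrak K-1$. -/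

import Mathlib

open Polynomial

noncomputable section

namespace GenChebyshev

/-- Left endpoints `-1, β₁, …, β_g` of the `g + 1` subintervals of `E`. -/
def bandLeft {g : ℕ} (β : Fin g → ℝ) : Fin (g + 1) → ℝ :=
  Fin.cons (-1) β

/-- Right endpoints `α₁, …, α_g, 1` of the `g + 1` subintervals of `E`. -/
def bandRight {g : ℕ} (α : Fin g → ℝ) : Fin (g + 1) → ℝ :=
  Fin.snoc α 1

/-- `-1 < α₁ < β₁ < α₂ < β₂ < ⋯ < α_g < β_g < 1`: all subintervals and all gaps are
nondegenerate. -/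
structure IsBranchPoints {g : ℕ} (α β : Fin g → ℝ) : Prop where
  band : ∀ k, bandLeft β k < bandRight α k
  gap : ∀ j, α j < β j

/-- The `k`-th subinterval of `E`. -/
def band {g : ℕ} (α β : Fin g → ℝ) (k : Fin (g + 1)) : Set ℝ :=
  Set.Icc (bandLeft β k) (bandRight α k)

/-- `E = [-1, α₁] ∪ [β₁, α₂] ∪ ⋯ ∪ [β_g, 1]`. -/
def E {g : ℕ} (α β : Fin g → ℝ) : Set ℝ :=
  ⋃ k, band α β k

/-- The weight on `E`. Its values at the finitely many endpoints, where the denominator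
may vanish, do not affect integrals. -/
def weight {g : ℕ} (α β : Fin g → ℝ) (x : ℝ) : ℝ :=
  1 / Real.pi * √((∏ j, (x - α j)) / ((1 - x ^ 2) * ∏ j, (x - β j)))

/-- The pairing `∫_E p q w dx`. -/
def pairing {g : ℕ} (α β : Fin g → ℝ) (p q : ℝ[X]) : ℝ :=
  ∫ x in E α β, p.eval x * q.eval x * weight α β x

/-- `P` is the sequence of monic polynomials, `P n` of degree `n`, orthogonal on `E` with
respect to the weight. -/
structure IsMonicOrthogonal {g : ℕ} (α β : Fin g → ℝ) (P : ℕ → ℝ[X]) : Prop where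
  monic : ∀ n, (P n).Monic
  natDegree_eq : ∀ n, (P n).natDegree = n
  orthogonal : ∀ m n, m ≠ n → pairing α β (P m) (P n) = 0

/-- `a₁, a₂, …` and `b₁, b₂, …` are the coefficients of the three-term recurrence
`x Pₙ = Pₙ₊₁ + bₙ₊₁ Pₙ + aₙ Pₙ₋₁` (`n ≥ 0`, `P₋₁ = 0`). The values `a 0`, `b 0` play no role. -/
structure IsRecurrence (P : ℕ → ℝ[X]) (a b : ℕ → ℝ) : Prop where
  zero : X * P 0 = P 1 + C (b 1) * P 0
  succ : ∀ n, X * P (n + 1) = P (n + 2) + C (b (n + 2)) * P (n + 1) + C (a (n + 1)) * P n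

/-- The recurrence coefficients have period `K`. The coefficient `a₁` is exceptional (it carries
an extra factor `2` already for the classical Chebyshev polynomials) and is left out. -/
structure HasPeriod (a b : ℕ → ℝ) (K : ℕ) : Prop where
  pos : 0 < K
  a_periodic : ∀ n, 2 ≤ n → a (n + K) = a n
  b_periodic : ∀ n, 1 ≤ n → b (n + K) = b n

/-- `Δₙ = √(2 hₙ)` with `hₙ = ∫_E Pₙ² w dx`. -/
def Delta {g : ℕ} (α β : Fin g → ℝ) (P : ℕ → ℝ[X]) (n : ℕ) : ℝ :=
  √(2 * pairing α β (P n) (P n))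

/-- The normalized polynomial `Pₙ / Δₙ`. -/
def normalized {g : ℕ} (α β : Fin g → ℝ) (P : ℕ → ℝ[X]) (n : ℕ) : ℝ[X] :=
  C (Delta α β P n)⁻¹ * P n

/-- The monic Chebyshev polynomial of the first kind of degree `n`. -/
def monicT (n : ℕ) : ℝ[X] :=
  C (Chebyshev.T ℝ n).leadingCoeff⁻¹ * Chebyshev.T ℝ n

end GenChebyshev

end

/-! ### Geometry of the bands and gaps, and the sign of `numer * denom`. -/

noncomputable section
namespace GenChebyshev

variable {g : ℕ} {α β : Fin g → ℝ}

/-! Write A for `numer α`, B for `denom β`, ψ for the Stieltjes transform of the weight, ψₙ for that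
of Pₙ w, and Qₙ for `secondKind a b n`.

The weight is chosen so that ψ² = A / B on (1, ∞) (`IsBranchPoints.stieltjes_one_sq`). To see this,
substitute u = `bandMap` on every band. The contributions of the g + 1 bands at a fixed u are the
partial fractions of a single rational function, and the remaining u-integral is elementary.

The functions ψₙ = Pₙ ψ - Qₙ satisfy the same recurrence as Pₙ, and zⁿ ψₙ → 0. By periodicity the
Casoratian of ψₙ and ψₙ₊ₖ (shift by the period K) depends on n only through a positive constant
factor, so it decays faster than every power of z. Expanded with ψ² = A / B, it has the form p + q ψ
with polynomials p and q up to the factor B. Since A / B is not the square of a rational function, p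
= q = 0 (`IsRecurrence.period_relations`).

These two identities give a₁ = 2 a_{K+1}, a polynomial S with Q_K = A S, and, via the Casoratian of
Pₙ and Qₙ, Pell's equation P_K² - A B S² = 2 h_K. Since A divides Q_K, which has degree K - 1, it
follows that g ≤ K - 1. The identities also yield addition formulas for index n + K, which are the
mixed recurrences of Tₙ and Uₙ in disguise (`IsRecurrence.mul_period`).

The preimage statements need the position of the zeros of S. With G = B S, the Christoffel–Darboux
argument gives monotonicity of G / P_K and P_K / Q_K on the line, and imaginary parts of fixed sign
in the upper half plane (`PellData`). Together with Pell's equation this forbids critical values of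
M_K in (-1, 1), real preimages outside E and nonreal preimages. On each band M_K is ±1 at both ends
and must reach both signs (`exists_eval_eq_neg_one`). -/

lemma bandLeft_succ (β : Fin g → ℝ) (j : Fin g) : bandLeft β j.succ = β j := by
  simp [bandLeft]

lemma bandLeft_zero (β : Fin g → ℝ) : bandLeft β 0 = -1 := by
  simp [bandLeft]

lemma bandRight_castSucc (α : Fin g → ℝ) (j : Fin g) : bandRight α j.castSucc = α j := by
  simp [bandRight]

lemma bandRight_last (α : Fin g → ℝ) : bandRight α (Fin.last g) = 1 := by
  simp [bandRight]

lemma IsBranchPoints.strictMono_bandLeft (h : IsBranchPoints α β) : StrictMono (bandLeft β) := by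
  rw [Fin.strictMono_iff_lt_succ]
  intro j
  rw [bandLeft_succ]
  have := h.band j.castSucc
  rw [bandRight_castSucc] at this
  exact this.trans (h.gap j)

lemma IsBranchPoints.strictMono_bandRight (h : IsBranchPoints α β) :
    StrictMono (bandRight α) := by
  rw [Fin.strictMono_iff_lt_succ]
  intro j
  rw [bandRight_castSucc]
  have := h.band j.succ
  rw [bandLeft_succ] at this
  exact (h.gap j).trans this

/-- A band with index at most `j` lies to the left of the `j`-th gap. -/
lemma IsBranchPoints.bandRight_le (h : IsBranchPoints α β) {k : Fin (g + 1)} {j : Fin g}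
    (hk : k ≤ j.castSucc) : bandRight α k ≤ α j := by
  rw [← bandRight_castSucc α j]
  exact h.strictMono_bandRight.monotone hk

/-- A band with index greater than `j` lies to the right of the `j`-th gap. -/
lemma IsBranchPoints.le_bandLeft (h : IsBranchPoints α β) {k : Fin (g + 1)} {j : Fin g}
    (hk : j.castSucc < k) : β j ≤ bandLeft β k := by
  rw [← bandLeft_succ β j]
  exact h.strictMono_bandLeft.monotone (Fin.castSucc_lt_iff_succ_le.mp hk)

lemma IsBranchPoints.neg_one_le_bandLeft (h : IsBranchPoints α β) (k : Fin (g + 1)) :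
    -1 ≤ bandLeft β k := by
  rw [← bandLeft_zero β]
  exact h.strictMono_bandLeft.monotone (Fin.zero_le k)

lemma IsBranchPoints.bandRight_le_one (h : IsBranchPoints α β) (k : Fin (g + 1)) :
    bandRight α k ≤ 1 := by
  rw [← bandRight_last α]
  exact h.strictMono_bandRight.monotone (Fin.le_last k)

lemma IsBranchPoints.neg_one_lt (h : IsBranchPoints α β) (j : Fin g) : -1 < α j := by
  rw [← bandRight_castSucc α j]
  exact (h.neg_one_le_bandLeft _).trans_lt (h.band _)

lemma IsBranchPoints.lt_one (h : IsBranchPoints α β) (j : Fin g) : β j < 1 := by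
  rw [← bandLeft_succ β j]
  exact (h.band _).trans_le (h.bandRight_le_one _)

lemma IsBranchPoints.mem_Icc_of_mem_band (h : IsBranchPoints α β) {k : Fin (g + 1)} {x : ℝ}
    (hx : x ∈ GenChebyshev.band α β k) : x ∈ Set.Icc (-1 : ℝ) 1 :=
  ⟨(h.neg_one_le_bandLeft k).trans hx.1, hx.2.trans (h.bandRight_le_one k)⟩

lemma IsBranchPoints.E_subset (h : IsBranchPoints α β) : E α β ⊆ Set.Icc (-1 : ℝ) 1 := by
  intro x hx
  obtain ⟨k, hk⟩ := Set.mem_iUnion.mp hx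
  exact h.mem_Icc_of_mem_band hk

lemma IsBranchPoints.sub_mul_sub_nonneg (h : IsBranchPoints α β) {k : Fin (g + 1)} {x : ℝ}
    (hx : x ∈ GenChebyshev.band α β k) (j : Fin g) : 0 ≤ (x - α j) * (x - β j) := by
  have hg := h.gap j
  rcases le_or_gt k j.castSucc with hk | hk
  · have := h.bandRight_le hk
    have := hx.2
    exact mul_nonneg_of_nonpos_of_nonpos (by linarith) (by linarith)
  · have := h.le_bandLeft hk
    have := hx.1
    exact mul_nonneg (by linarith) (by linarith)

lemma IsBranchPoints.sub_mul_sub_pos (h : IsBranchPoints α β) {k : Fin (g + 1)} {x : ℝ}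
    (hx : x ∈ Set.Ioo (bandLeft β k) (bandRight α k)) (j : Fin g) :
    0 < (x - α j) * (x - β j) := by
  have hg := h.gap j
  rcases le_or_gt k j.castSucc with hk | hk
  · have := h.bandRight_le hk
    have := hx.2
    exact mul_pos_of_neg_of_neg (by linarith) (by linarith)
  · have := h.le_bandLeft hk
    have := hx.1
    exact mul_pos (by linarith) (by linarith)

lemma IsBranchPoints.neg_one_lt_of_mem (h : IsBranchPoints α β) {k : Fin (g + 1)} {x : ℝ}
    (hx : x ∈ Set.Ioo (bandLeft β k) (bandRight α k)) : -1 < x :=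
  (h.neg_one_le_bandLeft k).trans_lt hx.1

lemma IsBranchPoints.lt_one_of_mem (h : IsBranchPoints α β) {k : Fin (g + 1)} {x : ℝ}
    (hx : x ∈ Set.Ioo (bandLeft β k) (bandRight α k)) : x < 1 :=
  hx.2.trans_le (h.bandRight_le_one k)

lemma IsBranchPoints.pairwise_disjoint_band (h : IsBranchPoints α β) :
    Pairwise (Function.onFun Disjoint (GenChebyshev.band α β)) := by
  have key : ∀ k l : Fin (g + 1), k < l →
      Disjoint (GenChebyshev.band α β k) (GenChebyshev.band α β l) := by
    intro k l hkl
    rw [Set.disjoint_left]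
    intro x hx hx'
    have hk : k ≠ Fin.last g := (hkl.trans_le (Fin.le_last l)).ne
    obtain ⟨j, rfl⟩ := Fin.exists_castSucc_eq.mpr hk
    have h1 := h.le_bandLeft hkl
    have h2 := hx.2
    rw [bandRight_castSucc] at h2
    linarith [hx'.1, h.gap j]
  intro k l hkl
  rcases lt_or_gt_of_ne hkl with hlt | hlt
  · exact key k l hlt
  · exact (key l k hlt).symm

/-- A point of `[-1, 1]` outside `E` lies in one of the gaps. -/
lemma IsBranchPoints.exists_gap {x : ℝ} (hx : x ∉ E α β) (h1 : -1 ≤ x)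
    (h2 : x ≤ 1) : ∃ j, x ∈ Set.Ioo (α j) (β j) := by
  classical
  -- Take the last band that starts at or before `x`; as `x` is not in it, `x` lies in the gap after
  -- it.
  let s : Finset (Fin (g + 1)) := Finset.univ.filter fun k => bandLeft β k ≤ x
  have hs : s.Nonempty := ⟨0, by simp [s, bandLeft_zero, h1]⟩
  set k := s.max' hs with hk
  have hkl : bandLeft β k ≤ x := by
    have := s.max'_mem hs
    simpa [s] using this
  have hkr : bandRight α k < x := by
    by_contra hcon
    exact hx (Set.mem_iUnion.mpr ⟨k, hkl, not_lt.mp hcon⟩)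
  have hlast : k ≠ Fin.last g := by
    intro hl
    rw [hl, bandRight_last] at hkr
    linarith
  obtain ⟨j, hj⟩ := Fin.exists_castSucc_eq.mpr hlast
  refine ⟨j, ?_, ?_⟩
  · rw [← hj, bandRight_castSucc] at hkr
    exact hkr
  · by_contra hcon
    have hmem : j.succ ∈ s := by
      simp only [s, Finset.mem_filter, Finset.mem_univ, true_and, bandLeft_succ]
      exact not_lt.mp hcon
    have := s.le_max' _ hmem
    rw [← hk, ← hj] at this
    exact absurd this (not_le.mpr (Fin.castSucc_lt_succ))

lemma IsBranchPoints.gap_sign (h : IsBranchPoints α β) {x : ℝ} {i j : Fin g} (hij : i ≠ j)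
    (hx : x ∈ Set.Ioo (α j) (β j)) : 0 < (x - α i) * (x - β i) := by
  have hg := h.gap i
  rcases lt_or_gt_of_ne hij with hlt | hlt
  · have h1 := h.le_bandLeft (k := j.castSucc) (j := i) (by simpa using hlt)
    have h2 := h.band j.castSucc
    rw [bandRight_castSucc] at h2
    have := hx.1
    exact mul_pos (by linarith) (by linarith)
  · have h1 := h.bandRight_le (k := j.succ) (j := i) (Fin.succ_le_castSucc_iff.mpr hlt)
    have h2 := h.band j.succ
    rw [bandLeft_succ] at h2
    have := hx.2
    exact mul_pos_of_neg_of_neg (by linarith) (by linarith)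

/-- The polynomial `∏ (x - α_j)`. -/
def numer (α : Fin g → ℝ) : ℝ[X] := ∏ j, (X - C (α j))

/-- The polynomial `(x² - 1) ∏ (x - β_j)`. -/
def denom (β : Fin g → ℝ) : ℝ[X] := (X ^ 2 - 1) * ∏ j, (X - C (β j))

lemma eval_numer (α : Fin g → ℝ) (x : ℝ) : (numer α).eval x = ∏ j, (x - α j) := by
  simp [numer, eval_prod]

lemma eval_denom (β : Fin g → ℝ) (x : ℝ) :
    (denom β).eval x = (x ^ 2 - 1) * ∏ j, (x - β j) := by
  simp [denom, eval_prod]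

lemma monic_numer (α : Fin g → ℝ) : (numer α).Monic :=
  monic_prod_of_monic _ _ fun j _ => monic_X_sub_C (α j)

lemma natDegree_numer (α : Fin g → ℝ) : (numer α).natDegree = g := by
  simp [numer]

lemma monic_X_sq_sub_one : (X ^ 2 - 1 : ℝ[X]).Monic := monic_X_pow_sub_C 1 two_ne_zero

lemma monic_denom (β : Fin g → ℝ) : (denom β).Monic :=
  monic_X_sq_sub_one.mul (monic_numer β)

lemma natDegree_denom (β : Fin g → ℝ) : (denom β).natDegree = g + 2 := by
  have h2 : (X ^ 2 - 1 : ℝ[X]).natDegree = 2 := natDegree_X_pow_sub_C (n := 2) (r := (1 : ℝ))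
  have h3 := monic_X_sq_sub_one.natDegree_mul (monic_numer β)
  rw [h2, natDegree_numer, add_comm] at h3
  exact h3

lemma eval_numer_mul_denom (α β : Fin g → ℝ) (x : ℝ) :
    (numer α).eval x * (denom β).eval x = (x ^ 2 - 1) * ∏ j, ((x - α j) * (x - β j)) := by
  rw [eval_numer, eval_denom, Finset.prod_mul_distrib]
  ring

lemma IsBranchPoints.numer_mul_denom_nonpos (h : IsBranchPoints α β) {x : ℝ}
    (hx : x ∈ E α β) : (numer α).eval x * (denom β).eval x ≤ 0 := by
  rw [eval_numer_mul_denom]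
  have h1 := h.E_subset hx
  obtain ⟨k, hk⟩ := Set.mem_iUnion.mp hx
  exact mul_nonpos_of_nonpos_of_nonneg (by nlinarith [h1.1, h1.2])
    (Finset.prod_nonneg fun j _ => h.sub_mul_sub_nonneg hk j)

lemma IsBranchPoints.numer_mul_denom_nonneg_of_gap (h : IsBranchPoints α β) {x : ℝ} {j : Fin g}
    (hx : x ∈ Set.Icc (α j) (β j)) : 0 ≤ (numer α).eval x * (denom β).eval x := by
  -- `gap_sign` needs an interior point of the gap; the weak inequality extends to the closed gap by
  -- continuity.
  have hcl : closure (Set.Ioo (α j) (β j)) = Set.Icc (α j) (β j) := closure_Ioo (h.gap j).ne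
  rw [← hcl] at hx
  have hc : Continuous fun x => (numer α).eval x * (denom β).eval x := by fun_prop
  refine closure_minimal ?_ (isClosed_le continuous_const hc) hx
  intro y hy
  simp only [Set.mem_ofPred_eq]
  rw [eval_numer_mul_denom, ← Finset.mul_prod_erase Finset.univ _ (Finset.mem_univ j)]
  have h1 := h.neg_one_lt j
  have h2 := h.lt_one j
  have h3 : 0 ≤ ∏ i ∈ Finset.univ.erase j, ((y - α i) * (y - β i)) :=
    Finset.prod_nonneg fun i hi => (h.gap_sign (Finset.ne_of_mem_erase hi) hy).le
  have h4 : (y - α j) * (y - β j) ≤ 0 :=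
    mul_nonpos_of_nonneg_of_nonpos (by linarith [hy.1]) (by linarith [hy.2])
  exact mul_nonneg_of_nonpos_of_nonpos (by nlinarith [hy.1, hy.2])
    (mul_nonpos_of_nonpos_of_nonneg h4 h3)

lemma IsBranchPoints.numer_mul_denom_nonneg_of_one_le (h : IsBranchPoints α β) {x : ℝ}
    (hx : 1 ≤ x) : 0 ≤ (numer α).eval x * (denom β).eval x := by
  rw [eval_numer_mul_denom]
  refine mul_nonneg (by nlinarith) (Finset.prod_nonneg fun j _ => ?_)
  have := h.lt_one j
  have := h.gap j
  exact mul_nonneg (by linarith) (by linarith)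

lemma IsBranchPoints.numer_mul_denom_nonneg_of_le_neg_one (h : IsBranchPoints α β) {x : ℝ}
    (hx : x ≤ -1) : 0 ≤ (numer α).eval x * (denom β).eval x := by
  rw [eval_numer_mul_denom]
  refine mul_nonneg (by nlinarith) (Finset.prod_nonneg fun j _ => ?_)
  have := h.neg_one_lt j
  have := h.gap j
  exact mul_nonneg_of_nonpos_of_nonpos (by linarith) (by linarith)

lemma denom_bandLeft (β : Fin g → ℝ) (k : Fin (g + 1)) :
    (denom β).eval (bandLeft β k) = 0 := by
  rw [eval_denom]
  induction k using Fin.cases with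
  | zero => simp [bandLeft_zero]
  | succ j =>
    rw [bandLeft_succ, Finset.prod_eq_zero (Finset.mem_univ j) (sub_self _), mul_zero]

lemma numer_mul_denom_bandRight (α β : Fin g → ℝ) (k : Fin (g + 1)) :
    (numer α).eval (bandRight α k) * (denom β).eval (bandRight α k) = 0 := by
  rw [eval_numer, eval_denom]
  induction k using Fin.lastCases with
  | last => simp [bandRight_last]
  | cast j =>
    rw [bandRight_castSucc, Finset.prod_eq_zero (Finset.mem_univ j) (sub_self _), zero_mul]

/-- A point where `numer * denom` vanishes is an endpoint of a band. -/
lemma IsBranchPoints.mem_E_of_numer_mul_denom_eq_zero (h : IsBranchPoints α β) {x : ℝ}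
    (hx : (numer α).eval x * (denom β).eval x = 0) : x ∈ E α β := by
  have hl : ∀ k, bandLeft β k ∈ E α β := fun k =>
    Set.mem_iUnion.mpr ⟨k, le_rfl, (h.band k).le⟩
  have hr : ∀ k, bandRight α k ∈ E α β := fun k =>
    Set.mem_iUnion.mpr ⟨k, (h.band k).le, le_rfl⟩
  rw [eval_numer, eval_denom] at hx
  rcases mul_eq_zero.mp hx with h0 | h0
  · obtain ⟨j, -, hj⟩ := Finset.prod_eq_zero_iff.mp h0
    rw [sub_eq_zero.mp hj, ← bandRight_castSucc α j]
    exact hr _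
  rcases mul_eq_zero.mp h0 with h0 | h0
  · have : (x - 1) * (x + 1) = 0 := by linarith
    rcases mul_eq_zero.mp this with h1 | h1
    · rw [sub_eq_zero.mp h1, ← bandRight_last α]
      exact hr _
    · rw [eq_neg_of_add_eq_zero_left h1, ← bandLeft_zero β]
      exact hl _
  · obtain ⟨j, -, hj⟩ := Finset.prod_eq_zero_iff.mp h0
    rw [sub_eq_zero.mp hj, ← bandLeft_succ β j]
    exact hl _

end GenChebyshev
end

/-! ### Evaluation of the Stieltjes transform of the weight. -/

noncomputable section
namespace GenChebyshev

open MeasureTheory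

variable {g : ℕ} {α β : Fin g → ℝ}

/-- The polynomial `(x - 1) ∏ (x - α_j)`, vanishing at the right endpoints of the bands. -/
def rightNodal (α : Fin g → ℝ) : ℝ[X] := (X - C 1) * numer α

/-- The polynomial `(x + 1) ∏ (x - β_j)`, vanishing at the left endpoints of the bands. -/
def leftNodal (β : Fin g → ℝ) : ℝ[X] := (X - C (-1)) * numer β

lemma eval_rightNodal (α : Fin g → ℝ) (x : ℝ) :
    (rightNodal α).eval x = (x - 1) * ∏ j, (x - α j) := by
  simp [rightNodal, eval_numer]

lemma eval_leftNodal (β : Fin g → ℝ) (x : ℝ) :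
    (leftNodal β).eval x = (x + 1) * ∏ j, (x - β j) := by
  simp [leftNodal, eval_numer]

lemma monic_rightNodal (α : Fin g → ℝ) : (rightNodal α).Monic :=
  (monic_X_sub_C 1).mul (monic_numer α)

lemma monic_leftNodal (β : Fin g → ℝ) : (leftNodal β).Monic :=
  (monic_X_sub_C (-1)).mul (monic_numer β)

lemma natDegree_rightNodal (α : Fin g → ℝ) : (rightNodal α).natDegree = g + 1 := by
  rw [rightNodal, (monic_X_sub_C 1).natDegree_mul (monic_numer α), natDegree_numer,
    natDegree_X_sub_C, add_comm]

lemma natDegree_leftNodal (β : Fin g → ℝ) : (leftNodal β).natDegree = g + 1 := by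
  rw [leftNodal, (monic_X_sub_C (-1)).natDegree_mul (monic_numer β), natDegree_numer,
    natDegree_X_sub_C, add_comm]

/-- The function `(1 - x) / (1 + x) ∏ (x - α_j) / (x - β_j)`, mapping each open band
bijectively onto `(0, ∞)`. -/
def bandMap (α β : Fin g → ℝ) (x : ℝ) : ℝ :=
  (1 - x) / (1 + x) * ∏ j, ((x - α j) / (x - β j))

lemma bandMap_eq (α β : Fin g → ℝ) (x : ℝ) :
    bandMap α β x = -((rightNodal α).eval x / (leftNodal β).eval x) := by
  rw [bandMap, eval_rightNodal, eval_leftNodal, Finset.prod_div_distrib, div_mul_div_comm,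
    ← neg_div]
  congr 1 <;> ring

lemma ne_zero_and_ne_zero_of_mul_pos {a b : ℝ} (h : 0 < a * b) : a ≠ 0 ∧ b ≠ 0 :=
  ⟨left_ne_zero_of_mul h.ne', right_ne_zero_of_mul h.ne'⟩

lemma IsBranchPoints.leftNodal_ne_zero (h : IsBranchPoints α β) {k : Fin (g + 1)} {x : ℝ}
    (hx : x ∈ Set.Ioo (bandLeft β k) (bandRight α k)) : (leftNodal β).eval x ≠ 0 := by
  rw [eval_leftNodal]
  have := h.neg_one_lt_of_mem hx
  exact mul_ne_zero (by linarith) (Finset.prod_ne_zero_iff.mpr fun j _ =>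
    (ne_zero_and_ne_zero_of_mul_pos (h.sub_mul_sub_pos hx j)).2)

lemma div_pos_of_mul_pos {a b : ℝ} (h : 0 < a * b) : 0 < a / b := by
  have hb := (ne_zero_and_ne_zero_of_mul_pos h).2
  have : a / b = a * b / b ^ 2 := by field_simp
  rw [this]
  positivity

lemma IsBranchPoints.bandMap_pos (h : IsBranchPoints α β) {k : Fin (g + 1)} {x : ℝ}
    (hx : x ∈ Set.Ioo (bandLeft β k) (bandRight α k)) : 0 < bandMap α β x := by
  have h1 := h.neg_one_lt_of_mem hx
  have h2 := h.lt_one_of_mem hx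
  exact mul_pos (div_pos (by linarith) (by linarith))
    (Finset.prod_pos fun j _ => div_pos_of_mul_pos (h.sub_mul_sub_pos hx j))

lemma IsBranchPoints.differentiableAt_bandMap (h : IsBranchPoints α β) {k : Fin (g + 1)} {x : ℝ}
    (hx : x ∈ Set.Ioo (bandLeft β k) (bandRight α k)) : DifferentiableAt ℝ (bandMap α β) x := by
  have : bandMap α β = fun x => -((rightNodal α).eval x / (leftNodal β).eval x) :=
    funext (bandMap_eq α β)
  rw [this]
  exact ((rightNodal α).differentiableAt.div (leftNodal β).differentiableAt
    (h.leftNodal_ne_zero hx)).neg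

lemma logDeriv_sub_div_sub {a b x : ℝ} (ha : x - a ≠ 0) (hb : x - b ≠ 0) :
    logDeriv (fun x => (x - a) / (x - b)) x = (a - b) / ((x - a) * (x - b)) := by
  rw [logDeriv_div x ha hb (by fun_prop) (by fun_prop)]
  simp only [logDeriv_apply, deriv_sub_const, deriv_id'']
  field_simp
  ring

/-- The logarithmic derivative is a sum over the factors: the Möbius factor in ±1 contributes a
negative term, and each α_j, β_j contributes (α_j - β_j) / ((x - α_j)(x - β_j)) < 0. As `bandMap` is
positive on the band, its derivative has the same sign. -/
lemma IsBranchPoints.deriv_bandMap_neg (h : IsBranchPoints α β) {k : Fin (g + 1)} {x : ℝ}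
    (hx : x ∈ Set.Ioo (bandLeft β k) (bandRight α k)) : deriv (bandMap α β) x < 0 := by
  have h1 := h.neg_one_lt_of_mem hx
  have h2 := h.lt_one_of_mem hx
  have hpos := h.bandMap_pos hx
  have hne : ∀ j, (x - α j) / (x - β j) ≠ 0 := fun j =>
    (div_pos_of_mul_pos (h.sub_mul_sub_pos hx j)).ne'
  have hd : ∀ j, DifferentiableAt ℝ (fun x => (x - α j) / (x - β j)) x := fun j =>
    DifferentiableAt.div (by fun_prop) (by fun_prop)
      (ne_zero_and_ne_zero_of_mul_pos (h.sub_mul_sub_pos hx j)).2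
  have hlog : logDeriv (bandMap α β) x < 0 := by
    have e : bandMap α β = fun x => (1 - x) / (1 + x) * ∏ j, ((x - α j) / (x - β j)) := rfl
    rw [e, logDeriv_mul x (f := fun x => (1 - x) / (1 + x))
      (g := fun x => ∏ j, ((x - α j) / (x - β j))) (div_pos (by linarith) (by linarith)).ne'
      (Finset.prod_ne_zero_iff.mpr fun j _ => hne j)
      (DifferentiableAt.div (by fun_prop) (by fun_prop) (by linarith))
      (DifferentiableAt.fun_finsetProd fun j _ => hd j)]
    have e1 : logDeriv (fun x : ℝ => (1 - x) / (1 + x)) x < 0 := by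
      rw [logDeriv_div x (by linarith) (by linarith) (by fun_prop) (by fun_prop)]
      have d1 : deriv (fun x : ℝ => 1 - x) x = -1 := ((hasDerivAt_id x).const_sub 1).deriv
      have d2 : deriv (fun x : ℝ => 1 + x) x = 1 := ((hasDerivAt_id x).const_add 1).deriv
      rw [logDeriv_apply, logDeriv_apply, d1, d2]
      have : -1 / (1 - x) < 0 := div_neg_of_neg_of_pos (by norm_num) (by linarith)
      have : 0 < 1 / (1 + x) := div_pos one_pos (by linarith)
      linarith
    have e2 : logDeriv (fun x => ∏ j, ((x - α j) / (x - β j))) x ≤ 0 := by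
      rw [logDeriv_prod (fun j _ => hne j) fun j _ => hd j]
      refine Finset.sum_nonpos fun j _ => ?_
      have hj := h.sub_mul_sub_pos hx j
      rw [logDeriv_sub_div_sub (ne_zero_and_ne_zero_of_mul_pos hj).1 (ne_zero_and_ne_zero_of_mul_pos hj).2]
      exact (div_neg_of_neg_of_pos (by linarith [h.gap j]) hj).le
    linarith
  rw [logDeriv_apply] at hlog
  by_contra hcon
  exact absurd hlog (not_lt.mpr (div_nonneg (not_lt.mp hcon) hpos.le))

lemma IsBranchPoints.strictAntiOn_bandMap (h : IsBranchPoints α β) (k : Fin (g + 1)) :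
    StrictAntiOn (bandMap α β) (Set.Ioo (bandLeft β k) (bandRight α k)) := by
  refine strictAntiOn_of_deriv_neg (convex_Ioo _ _)
    (fun x hx => (h.differentiableAt_bandMap hx).continuousAt.continuousWithinAt) ?_
  rw [interior_Ioo]
  exact fun x hx => h.deriv_bandMap_neg hx

/-- The polynomial whose roots are the preimages of `u` under `bandMap`. -/
def levelPoly (α β : Fin g → ℝ) (u : ℝ) : ℝ[X] := rightNodal α + C u * leftNodal β

lemma IsBranchPoints.eval_levelPoly (h : IsBranchPoints α β) {k : Fin (g + 1)} {x : ℝ}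
    (hx : x ∈ Set.Ioo (bandLeft β k) (bandRight α k)) (u : ℝ) :
    (levelPoly α β u).eval x = (u - bandMap α β x) * (leftNodal β).eval x := by
  have := h.leftNodal_ne_zero hx
  rw [bandMap_eq, levelPoly]
  simp only [eval_add, eval_mul, eval_C]
  field_simp
  ring

lemma IsBranchPoints.eval_derivative_levelPoly (h : IsBranchPoints α β) {k : Fin (g + 1)} {x : ℝ}
    (hx : x ∈ Set.Ioo (bandLeft β k) (bandRight α k)) :
    (levelPoly α β (bandMap α β x)).derivative.eval x =
      -deriv (bandMap α β) x * (leftNodal β).eval x := by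
  have hne := h.leftNodal_ne_zero hx
  have hd : deriv (bandMap α β) x = -(((rightNodal α).derivative.eval x * (leftNodal β).eval x -
      (rightNodal α).eval x * (leftNodal β).derivative.eval x) / (leftNodal β).eval x ^ 2) := by
    have e : bandMap α β = fun x => -((rightNodal α).eval x / (leftNodal β).eval x) :=
      funext (bandMap_eq α β)
    rw [e]
    exact (((rightNodal α).hasDerivAt x).fun_div ((leftNodal β).hasDerivAt x) hne).fun_neg.deriv
  rw [hd, bandMap_eq, levelPoly]
  simp only [derivative_add, derivative_mul, derivative_C, eval_add, eval_mul, eval_C, zero_mul,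
    zero_add]
  field_simp
  ring

/-- At the left end only the `rightNodal` term survives, at the right end only the `leftNodal` term,
and these two values have opposite signs. Working with the polynomial avoids the pole of `bandMap`
at the left end. -/
lemma IsBranchPoints.exists_root_levelPoly (h : IsBranchPoints α β) (k : Fin (g + 1)) {u : ℝ}
    (hu : 0 < u) :
    ∃ x ∈ Set.Ioo (bandLeft β k) (bandRight α k), (levelPoly α β u).eval x = 0 := by
  set l := bandLeft β k with hl
  set r := bandRight α k with hr
  have hlr : l < r := h.band k
  have hl1 : -1 ≤ l := h.neg_one_le_bandLeft k
  have hr1 : r ≤ 1 := h.bandRight_le_one k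
  have el : (leftNodal β).eval l = 0 := by
    have h0 := denom_bandLeft β k
    rw [eval_denom, ← hl] at h0
    rw [eval_leftNodal]
    rcases mul_eq_zero.mp h0 with h1 | h1
    · have h2 : (l + 1) * (l - 1) = 0 := by linarith
      rw [(mul_eq_zero.mp h2).resolve_right (by linarith), zero_mul]
    · rw [h1, mul_zero]
  have er : (rightNodal α).eval r = 0 := by
    rw [eval_rightNodal, hr]
    induction k using Fin.lastCases with
    | last => simp [bandRight_last]
    | cast j =>
      rw [bandRight_castSucc, Finset.prod_eq_zero (Finset.mem_univ j) (sub_self _), mul_zero]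
  have hneg : (rightNodal α).eval l * (leftNodal β).eval r < 0 := by
    have e : (rightNodal α).eval l * (leftNodal β).eval r =
        ((l - 1) * (r + 1)) * ∏ j, ((l - α j) * (r - β j)) := by
      rw [eval_rightNodal, eval_leftNodal, Finset.prod_mul_distrib]
      ring
    rw [e]
    refine mul_neg_of_neg_of_pos (mul_neg_of_neg_of_pos (by linarith) (by linarith))
      (Finset.prod_pos fun j _ => ?_)
    have hg := h.gap j
    rcases le_or_gt k j.castSucc with hk | hk
    · have := h.bandRight_le hk
      exact mul_pos_of_neg_of_neg (by linarith) (by linarith)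
    · have := h.le_bandLeft hk
      exact mul_pos (by linarith) (by linarith)
  have hHl : (levelPoly α β u).eval l = (rightNodal α).eval l := by
    simp [levelPoly, el]
  have hHr : (levelPoly α β u).eval r = u * (leftNodal β).eval r := by
    simp [levelPoly, er]
  have hc : ContinuousOn (fun x => (levelPoly α β u).eval x) (Set.Icc l r) := by fun_prop
  rcases mul_neg_iff.mp hneg with ⟨h1, h2⟩ | ⟨h1, h2⟩
  · have hmem : (0 : ℝ) ∈ Set.Ioo ((levelPoly α β u).eval r) ((levelPoly α β u).eval l) := by
      rw [hHl, hHr]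
      exact ⟨mul_neg_of_pos_of_neg hu h2, h1⟩
    exact intermediate_value_Ioo' hlr.le hc hmem
  · have hmem : (0 : ℝ) ∈ Set.Ioo ((levelPoly α β u).eval l) ((levelPoly α β u).eval r) := by
      rw [hHl, hHr]
      exact ⟨h1, mul_pos hu h2⟩
    exact intermediate_value_Ioo hlr.le hc hmem

lemma IsBranchPoints.exists_bandMap_eq (h : IsBranchPoints α β) (k : Fin (g + 1)) {u : ℝ}
    (hu : 0 < u) : ∃ x ∈ Set.Ioo (bandLeft β k) (bandRight α k), bandMap α β x = u := by
  obtain ⟨x, hx, hx0⟩ := h.exists_root_levelPoly k hu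
  refine ⟨x, hx, ?_⟩
  rw [h.eval_levelPoly hx] at hx0
  have := (mul_eq_zero.mp hx0).resolve_right (h.leftNodal_ne_zero hx)
  linarith

lemma IsBranchPoints.image_bandMap (h : IsBranchPoints α β) (k : Fin (g + 1)) :
    bandMap α β '' Set.Ioo (bandLeft β k) (bandRight α k) = Set.Ioi 0 := by
  ext u
  constructor
  · rintro ⟨x, hx, rfl⟩
    exact h.bandMap_pos hx
  · exact fun hu => h.exists_bandMap_eq k hu

/-- Partial fractions of `p / q` for a polynomial `q` with simple real roots. -/
lemma div_eq_sum_of_roots {n : ℕ} {p q : ℝ[X]} {c : ℝ} {v : Fin n → ℝ} (hv : Function.Injective v)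
    (hq : q = C c * Lagrange.nodal Finset.univ v) (hp : p.degree < n) {z : ℝ}
    (hz : ∀ i, z ≠ v i) :
    p.eval z / q.eval z = ∑ i, p.eval (v i) / q.derivative.eval (v i) / (z - v i) := by
  have hp' := Lagrange.eq_interpolate_of_eval_eq (s := Finset.univ) (v := v)
    (fun i => p.eval (v i)) (f := p) hv.injOn (by simpa using hp) (fun i _ => rfl)
  have hN : (Lagrange.nodal Finset.univ v).eval z ≠ 0 := by
    rw [Lagrange.eval_nodal]
    exact Finset.prod_ne_zero_iff.mpr fun i _ => sub_ne_zero.mpr (hz i)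
  have e1 : p.eval z = (Lagrange.nodal Finset.univ v).eval z *
      ∑ i, Lagrange.nodalWeight Finset.univ v i * (z - v i)⁻¹ * p.eval (v i) := by
    conv_lhs => rw [hp']
    exact Lagrange.eval_interpolate_not_at_node _ fun i _ => hz i
  rw [e1, hq, eval_mul, eval_C, mul_comm c, mul_div_mul_left _ _ hN, Finset.sum_div]
  refine Finset.sum_congr rfl fun i _ => ?_
  rw [Lagrange.nodalWeight_eq_eval_derivative_nodal (Finset.mem_univ i)]
  simp only [derivative_mul, derivative_C, zero_mul, zero_add, eval_mul, eval_C]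
  simp only [div_eq_mul_inv, mul_inv]
  ring

/-- Both sides have the term (1 + u) x^(g+1), so their difference has degree at most g and vanishes
at g + 1 points. -/
lemma levelPoly_eq_nodal {u : ℝ} {v : Fin (g + 1) → ℝ}
    (hv : Function.Injective v) (hroot : ∀ k, (levelPoly α β u).eval (v k) = 0) :
    levelPoly α β u = C (1 + u) * Lagrange.nodal Finset.univ v := by
  refine eq_of_degree_sub_lt_of_eval_index_eq (v := v) Finset.univ hv.injOn ?_ ?_
  · have hd1 : (rightNodal α).degree = ((g + 1 : ℕ) : WithBot ℕ) := by
      rw [degree_eq_natDegree (monic_rightNodal α).ne_zero, natDegree_rightNodal]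
    have hd2 : (leftNodal β).degree = ((g + 1 : ℕ) : WithBot ℕ) := by
      rw [degree_eq_natDegree (monic_leftNodal β).ne_zero, natDegree_leftNodal]
    have hd3 : (Lagrange.nodal Finset.univ v).degree = ((g + 1 : ℕ) : WithBot ℕ) := by
      rw [Lagrange.degree_nodal]; simp
    have hm := Lagrange.nodal_monic (s := (Finset.univ : Finset (Fin (g + 1)))) (v := v)
    have e : levelPoly α β u - C (1 + u) * Lagrange.nodal Finset.univ v =
        (rightNodal α - Lagrange.nodal Finset.univ v) +
          C u * (leftNodal β - Lagrange.nodal Finset.univ v) := by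
      rw [levelPoly, C_add, C_1]
      ring
    rw [e]
    have l1 : (rightNodal α - Lagrange.nodal Finset.univ v).degree < ((g + 1 : ℕ) : WithBot ℕ) := by
      rw [← hd1]
      exact degree_sub_lt_left (by rw [hd1, hd3]) (monic_rightNodal α).ne_zero
        (by rw [(monic_rightNodal α).leadingCoeff, hm.leadingCoeff])
    have l2 : (leftNodal β - Lagrange.nodal Finset.univ v).degree < ((g + 1 : ℕ) : WithBot ℕ) := by
      rw [← hd2]
      exact degree_sub_lt_left (by rw [hd2, hd3]) (monic_leftNodal β).ne_zero
        (by rw [(monic_leftNodal β).leadingCoeff, hm.leadingCoeff])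
    rw [Finset.card_univ, Fintype.card_fin]
    refine (degree_add_le _ _).trans_lt (max_lt l1 (lt_of_le_of_lt ?_ l2))
    refine (degree_mul_le _ _).trans ?_
    calc (C u : ℝ[X]).degree + _ ≤ 0 + _ := by gcongr; exact degree_C_le
      _ = _ := zero_add _
  · intro k _
    rw [hroot k, eval_mul, Lagrange.eval_nodal_at_node (Finset.mem_univ k), mul_zero]

/-- An antiderivative is a multiple of arctan(√(b / a) √u). Integrability comes for free from
nonnegativity and the limit at infinity. -/
lemma integral_inv_sqrt_div {a b : ℝ} (ha : 0 < a) (hb : 0 < b) :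
    IntegrableOn (fun u : ℝ => (√u)⁻¹ / (a + b * u)) (Set.Ioi 0) ∧
      ∫ u in Set.Ioi (0 : ℝ), (√u)⁻¹ / (a + b * u) = Real.pi / √(a * b) := by
  set G : ℝ → ℝ := fun u => 2 / √(a * b) * Real.arctan (√(b / a) * √u) with hG
  have hab : 0 < √(a * b) := Real.sqrt_pos.mpr (mul_pos ha hb)
  have hba : 0 < √(b / a) := Real.sqrt_pos.mpr (div_pos hb ha)
  have hcont : ContinuousWithinAt G (Set.Ici 0) 0 := by
    have : Continuous G := by fun_prop
    exact this.continuousWithinAt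
  have hderiv : ∀ u ∈ Set.Ioi (0 : ℝ), HasDerivAt G ((√u)⁻¹ / (a + b * u)) u := by
    intro u hu
    have hu' : (0 : ℝ) < u := hu
    have h1 := (((Real.hasDerivAt_sqrt hu'.ne').const_mul √(b / a)).arctan).const_mul
      (2 / √(a * b))
    refine h1.congr_deriv ?_
    have e1 : √(a * b) = a * √(b / a) := by
      rw [show a * b = a ^ 2 * (b / a) by field_simp, Real.sqrt_mul (by positivity),
        Real.sqrt_sq ha.le]
    have e2 : (√(b / a) * √u) ^ 2 = b / a * u := by
      rw [mul_pow, Real.sq_sqrt (div_pos hb ha).le, Real.sq_sqrt hu'.le]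
    rw [e2, e1]
    have : 0 < √u := Real.sqrt_pos.mpr hu'
    have : 0 < a + b * u := by positivity
    field_simp
  have hnn : ∀ u ∈ Set.Ioi (0 : ℝ), 0 ≤ (√u)⁻¹ / (a + b * u) := by
    intro u hu
    have hu' : (0 : ℝ) < u := hu
    positivity
  have hlim : Filter.Tendsto G Filter.atTop (nhds (Real.pi / √(a * b))) := by
    have h1 : Filter.Tendsto (fun u : ℝ => √(b / a) * √u) Filter.atTop Filter.atTop :=
      Real.tendsto_sqrt_atTop.const_mul_atTop hba
    have h2 := ((Real.tendsto_arctan_atTop.mono_right nhdsWithin_le_nhds).comp h1).const_mul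
      (2 / √(a * b))
    have e : 2 / √(a * b) * (Real.pi / 2) = Real.pi / √(a * b) := by ring
    rw [e] at h2
    exact h2
  refine ⟨integrableOn_Ioi_deriv_of_nonneg hcont hderiv hnn hlim, ?_⟩
  rw [integral_Ioi_of_hasDerivAt_of_nonneg hcont hderiv hnn hlim]
  simp [hG]

/-- In this form the substitution u = `bandMap` turns the square root into √u. -/
lemma IsBranchPoints.weight_eq (h : IsBranchPoints α β) {k : Fin (g + 1)} {x : ℝ}
    (hx : x ∈ Set.Ioo (bandLeft β k) (bandRight α k)) :
    weight α β x = 1 / Real.pi * (√(bandMap α β x) / (1 - x)) := by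
  have h1 := h.neg_one_lt_of_mem hx
  have h2 := h.lt_one_of_mem hx
  have e : √(bandMap α β x) / (1 - x) = √(bandMap α β x / (1 - x) ^ 2) := by
    rw [Real.sqrt_div (h.bandMap_pos hx).le, Real.sqrt_sq (by linarith)]
  rw [weight, e]
  congr 2
  have h3 : ∏ j, (x - β j) ≠ 0 := Finset.prod_ne_zero_iff.mpr fun j _ =>
    (ne_zero_and_ne_zero_of_mul_pos (h.sub_mul_sub_pos hx j)).2
  rw [bandMap, Finset.prod_div_distrib, show 1 - x ^ 2 = (1 - x) * (1 + x) by ring]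
  have : 1 - x ≠ 0 := by linarith
  have : 1 + x ≠ 0 := by linarith
  field_simp

lemma measurableSet_band (α β : Fin g → ℝ) (k : Fin (g + 1)) : MeasurableSet (band α β k) :=
  measurableSet_Icc

lemma measurable_weight (α β : Fin g → ℝ) : Measurable (weight α β) := by
  unfold weight
  fun_prop

lemma IsBranchPoints.prod_sub_pos (h : IsBranchPoints α β) {z : ℝ} (hz : 1 < z) :
    0 < ∏ j, (z - α j) ∧ 0 < ∏ j, (z - β j) :=
  ⟨Finset.prod_pos fun j _ => by linarith [h.gap j, h.lt_one j],
    Finset.prod_pos fun j _ => by linarith [h.lt_one j]⟩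

/-- The Stieltjes transform of the weight, as a Lebesgue integral. -/
lemma IsBranchPoints.lintegral_weight_div (h : IsBranchPoints α β) {z : ℝ} (hz : 1 < z) :
    ∫⁻ x in E α β, ENNReal.ofReal (weight α β x / (z - x)) =
      ENNReal.ofReal √((numer α).eval z / (denom β).eval z) := by
  -- `v k` is the inverse of `bandMap` on the `k`-th band.
  choose! v hvmem hv using fun k => fun u (hu : 0 < u) => h.exists_bandMap_eq k hu
  have hvx : ∀ k, ∀ x ∈ Set.Ioo (bandLeft β k) (bandRight α k), v k (bandMap α β x) = x := by
    intro k x hx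
    exact (h.strictAntiOn_bandMap k).injOn (hvmem k _ (h.bandMap_pos hx)) hx
      (hv k _ (h.bandMap_pos hx))
  -- Monotonicity of the inverse branches is used for their measurability.
  have hvanti : ∀ k, AntitoneOn (v k) (Set.Ioi 0) := by
    intro k u hu u' hu' huu'
    by_contra hcon
    have := h.strictAntiOn_bandMap k (hvmem k u hu) (hvmem k u' hu') (not_le.mp hcon)
    rw [hv k u hu, hv k u' hu'] at this
    exact absurd huu' (not_le.mpr this)
  -- The integrand on the `k`-th band after the substitution, with √u written as u (√u)⁻¹ so that
  -- the other factor is a term of a partial fraction expansion.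
  let φ : Fin (g + 1) → ℝ → ℝ := fun k u => 1 / Real.pi * ((√u)⁻¹ *
    (u / ((1 - v k u) * -deriv (bandMap α β) (v k u)) / (z - v k u)))
  have hφ : ∀ k, ∀ u ∈ Set.Ioi (0 : ℝ), 0 ≤ φ k u := by
    intro k u hu
    have hu' : (0 : ℝ) < u := hu
    have h1 := h.lt_one_of_mem (hvmem k u hu)
    have h2 := h.deriv_bandMap_neg (hvmem k u hu)
    have h3 : 0 < 1 - v k u := by linarith
    have h4 : 0 < -deriv (bandMap α β) (v k u) := by linarith
    have h5 : 0 < z - v k u := by linarith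
    have := Real.pi_pos
    positivity
  have hmeas : ∀ k, AEMeasurable (fun u => ENNReal.ofReal (φ k u))
      (volume.restrict (Set.Ioi (0 : ℝ))) := by
    intro k
    have hvm : AEMeasurable (v k) (volume.restrict (Set.Ioi (0 : ℝ))) :=
      aemeasurable_restrict_of_antitoneOn measurableSet_Ioi (hvanti k)
    have hd : AEMeasurable (fun u => deriv (bandMap α β) (v k u))
        (volume.restrict (Set.Ioi (0 : ℝ))) :=
      (measurable_deriv (bandMap α β)).comp_aemeasurable hvm
    have hs : AEMeasurable (fun u : ℝ => √u) (volume.restrict (Set.Ioi (0 : ℝ))) :=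
      Real.continuous_sqrt.aemeasurable
    refine AEMeasurable.ennreal_ofReal ?_
    exact ((hs.inv.mul ((aemeasurable_id.div ((aemeasurable_const.sub hvm).mul hd.neg)).div
      (aemeasurable_const.sub hvm)))).const_mul _
  have hband : ∀ k, ∫⁻ x in GenChebyshev.band α β k, ENNReal.ofReal (weight α β x / (z - x)) =
      ∫⁻ u in Set.Ioi (0 : ℝ), ENNReal.ofReal (φ k u) := by
    intro k
    have e1 : ∫⁻ x in GenChebyshev.band α β k, ENNReal.ofReal (weight α β x / (z - x)) =
        ∫⁻ x in Set.Ioo (bandLeft β k) (bandRight α k),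
          ENNReal.ofReal (weight α β x / (z - x)) :=
      setLIntegral_congr Ioo_ae_eq_Icc.symm
    rw [e1, ← h.image_bandMap k, lintegral_image_eq_lintegral_abs_deriv_mul measurableSet_Ioo
      (fun x hx => (h.differentiableAt_bandMap hx).hasDerivAt.hasDerivWithinAt)
      (h.strictAntiOn_bandMap k).injOn]
    refine setLIntegral_congr_fun measurableSet_Ioo fun x hx => ?_
    have h1 := h.lt_one_of_mem hx
    have h2 := h.deriv_bandMap_neg hx
    have h3 := h.bandMap_pos hx
    rw [← ENNReal.ofReal_mul (abs_nonneg _)]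
    congr 1
    simp only [φ]
    rw [hvx k x hx, h.weight_eq hx, abs_of_neg h2]
    have h4 : 1 - x ≠ 0 := by linarith
    have h5 : z - x ≠ 0 := by linarith
    have h6 := h2.ne
    have h7 : √(bandMap α β x) ≠ 0 := (Real.sqrt_pos.mpr h3).ne'
    have h8 := Real.pi_ne_zero
    field_simp
    rw [Real.sq_sqrt h3.le]
  have hz1 := (h.prod_sub_pos hz).1
  have hz2 := (h.prod_sub_pos hz).2
  have hzr : 0 < (rightNodal α).eval z := by
    rw [eval_rightNodal]
    exact mul_pos (by linarith) hz1
  have hzl : 0 < (leftNodal β).eval z := by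
    rw [eval_leftNodal]
    exact mul_pos (by linarith) hz2
  -- For fixed `u` the points `v k u` are all the roots of `levelPoly α β u`, and the summands are
  -- the partial fractions of `numer α / levelPoly α β u` at `z`.
  have hsum : ∀ u ∈ Set.Ioi (0 : ℝ), ∑ k, ENNReal.ofReal (φ k u) =
      ENNReal.ofReal (1 / Real.pi * (numer α).eval z *
        ((√u)⁻¹ / ((rightNodal α).eval z + (leftNodal β).eval z * u))) := by
    intro u hu
    have hu' : (0 : ℝ) < u := hu
    rw [← ENNReal.ofReal_sum_of_nonneg fun k _ => hφ k u hu]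
    congr 1
    have hinj : Function.Injective fun k => v k u := by
      intro k l hkl
      by_contra hne
      have := h.pairwise_disjoint_band hne
      refine Set.disjoint_left.mp this (Set.Ioo_subset_Icc_self (hvmem k u hu)) ?_
      simp only at hkl
      rw [hkl]
      exact Set.Ioo_subset_Icc_self (hvmem l u hu)
    have hroot : ∀ k, (levelPoly α β u).eval (v k u) = 0 := by
      intro k
      rw [h.eval_levelPoly (hvmem k u hu), hv k u hu, sub_self, zero_mul]
    have hpf := div_eq_sum_of_roots (p := numer α) hinj (levelPoly_eq_nodal hinj hroot)
      (by
        rw [degree_eq_natDegree (monic_numer α).ne_zero, natDegree_numer]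
        exact_mod_cast Nat.lt_succ_self g) (z := z)
      (fun k => by linarith [h.lt_one_of_mem (hvmem k u hu)])
    have e : (levelPoly α β u).eval z = (rightNodal α).eval z + (leftNodal β).eval z * u := by
      simp [levelPoly, mul_comm]
    rw [e] at hpf
    rw [show 1 / Real.pi * (numer α).eval z *
        ((√u)⁻¹ / ((rightNodal α).eval z + (leftNodal β).eval z * u)) =
      1 / Real.pi * ((√u)⁻¹ * ((numer α).eval z /
        ((rightNodal α).eval z + (leftNodal β).eval z * u))) by ring, hpf, Finset.mul_sum,
      Finset.mul_sum]
    refine Finset.sum_congr rfl fun k _ => ?_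
    simp only [φ]
    -- It remains to match the residue A(v) / H'(v), where H is the level polynomial: H' =
    -- -`bandMap`' · `leftNodal` at v, and A(v) (1 - v) = u · `leftNodal`(v).
    congr 3
    have hm := hvmem k u hu
    have h1 := h.lt_one_of_mem hm
    have hD := h.eval_derivative_levelPoly hm
    rw [hv k u hu] at hD
    rw [hD]
    have hb := bandMap_eq α β (v k u)
    rw [hv k u hu, eval_rightNodal, ← eval_numer] at hb
    have hl := h.leftNodal_ne_zero hm
    have h2 := (h.deriv_bandMap_neg hm).ne
    have h3 : 1 - v k u ≠ 0 := by linarith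
    rw [div_eq_div_iff (mul_ne_zero h3 (neg_ne_zero.mpr h2))
      (mul_ne_zero (neg_ne_zero.mpr h2) hl)]
    have hb' : u * (leftNodal β).eval (v k u) = -((v k u - 1) * (numer α).eval (v k u)) := by
      rw [← neg_div] at hb
      rw [(eq_div_iff hl).mp hb]
    linear_combination (-deriv (bandMap α β) (v k u)) * hb'
  have hE : E α β = ⋃ k, GenChebyshev.band α β k := rfl
  rw [hE, lintegral_iUnion (measurableSet_band α β) h.pairwise_disjoint_band, tsum_fintype]
  simp only [hband]
  rw [← lintegral_finsetSum' _ fun k _ => hmeas k, setLIntegral_congr_fun measurableSet_Ioi hsum]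
  obtain ⟨hi, hval⟩ := integral_inv_sqrt_div hzr hzl
  rw [← ofReal_integral_eq_lintegral_ofReal (hi.const_mul _), integral_const_mul, hval]
  · congr 1
    have hA : 0 < (numer α).eval z := by rw [eval_numer]; exact hz1
    have e1 : (rightNodal α).eval z * (leftNodal β).eval z =
        (numer α).eval z ^ 2 * ((denom β).eval z / (numer α).eval z) := by
      rw [eval_rightNodal, eval_leftNodal, ← eval_numer, eval_denom]
      field_simp
      ring
    rw [e1, Real.sqrt_mul (by positivity), Real.sqrt_sq hA.le,
      ← inv_div ((denom β).eval z) ((numer α).eval z), Real.sqrt_inv]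
    have := Real.pi_ne_zero
    by_cases h0 : √((denom β).eval z / (numer α).eval z) = 0
    · simp [h0]
    · field_simp
  · refine (ae_restrict_iff' measurableSet_Ioi).mpr (Filter.Eventually.of_forall fun u hu => ?_)
    have hu' : (0 : ℝ) < u := hu
    have hA : 0 < (numer α).eval z := by rw [eval_numer]; exact hz1
    have := Real.pi_pos
    simp only [Pi.zero_apply]
    positivity

end GenChebyshev
end

/-! ### Moments and Stieltjes transforms: integrability, algebra and decay. -/

noncomputable section
namespace GenChebyshev

open MeasureTheory Filter Topology

variable {g : ℕ} {α β : Fin g → ℝ}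

lemma isCompact_E (α β : Fin g → ℝ) : IsCompact (E α β) :=
  isCompact_iUnion fun _ => isCompact_Icc

lemma measurableSet_E (α β : Fin g → ℝ) : MeasurableSet (E α β) :=
  (isCompact_E α β).measurableSet

lemma weight_nonneg (α β : Fin g → ℝ) (x : ℝ) : 0 ≤ weight α β x :=
  mul_nonneg (div_nonneg zero_le_one Real.pi_pos.le) (Real.sqrt_nonneg _)

/-- The Lebesgue integral of w / (2 - x) was found to be finite; multiplying by the continuous
function 2 - x on compact E gives w itself. -/
lemma IsBranchPoints.integrableOn_weight (h : IsBranchPoints α β) :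
    IntegrableOn (weight α β) (E α β) := by
  have h2 := h.lintegral_weight_div (z := 2) one_lt_two
  have hi : IntegrableOn (fun x => weight α β x / (2 - x)) (E α β) := by
    have hm : Measurable fun x => weight α β x / (2 - x) :=
      (measurable_weight α β).div (measurable_const.sub measurable_id)
    refine ⟨hm.aestronglyMeasurable, ?_⟩
    rw [hasFiniteIntegral_iff_ofReal, h2]
    · exact ENNReal.ofReal_lt_top
    · refine (ae_restrict_iff' (measurableSet_E α β)).mpr (Eventually.of_forall fun x hx => ?_)
      have := (h.E_subset hx).2
      exact div_nonneg (weight_nonneg α β x) (by linarith)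
  have h3 := hi.continuousOn_mul (g := fun x => 2 - x) (by fun_prop) (isCompact_E α β)
  refine h3.congr_fun (fun x hx => ?_) (measurableSet_E α β)
  have := (h.E_subset hx).2
  have : 2 - x ≠ 0 := by linarith
  simp only
  field_simp

lemma IsBranchPoints.integrableOn_mul_weight (h : IsBranchPoints α β) {f : ℝ → ℝ}
    (hf : ContinuousOn f (E α β)) : IntegrableOn (fun x => f x * weight α β x) (E α β) :=
  h.integrableOn_weight.continuousOn_mul hf (isCompact_E α β)

/-- The integral `∫_E p w dx`. -/
def mean (α β : Fin g → ℝ) (p : ℝ[X]) : ℝ := ∫ x in E α β, p.eval x * weight α β x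

/-- The Stieltjes transform `∫_E p(x) w(x) / (z - x) dx`. -/
def stieltjes (α β : Fin g → ℝ) (p : ℝ[X]) (z : ℝ) : ℝ :=
  ∫ x in E α β, p.eval x * (z - x)⁻¹ * weight α β x

lemma pairing_eq_mean (α β : Fin g → ℝ) (p q : ℝ[X]) : pairing α β p q = mean α β (p * q) := by
  simp [pairing, mean]

lemma IsBranchPoints.mean_add (h : IsBranchPoints α β) (p q : ℝ[X]) :
    mean α β (p + q) = mean α β p + mean α β q := by
  unfold mean
  rw [← integral_add (h.integrableOn_mul_weight (by fun_prop))
    (h.integrableOn_mul_weight (by fun_prop))]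
  simp [add_mul]

lemma mean_C_mul (c : ℝ) (p : ℝ[X]) :
    mean α β (C c * p) = c * mean α β p := by
  unfold mean
  rw [← integral_const_mul]
  simp [mul_assoc]

lemma IsBranchPoints.continuousOn_inv_sub (h : IsBranchPoints α β) {z : ℝ} (hz : 1 < z) :
    ContinuousOn (fun x => (z - x)⁻¹) (E α β) := by
  refine ContinuousOn.inv₀ (by fun_prop) fun x hx => ?_
  have := (h.E_subset hx).2
  linarith

lemma IsBranchPoints.integrableOn_stieltjes (h : IsBranchPoints α β) (p : ℝ[X]) {z : ℝ}
    (hz : 1 < z) : IntegrableOn (fun x => p.eval x * (z - x)⁻¹ * weight α β x) (E α β) :=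
  h.integrableOn_mul_weight (ContinuousOn.mul (by fun_prop) (h.continuousOn_inv_sub hz))

lemma IsBranchPoints.stieltjes_add (h : IsBranchPoints α β) (p q : ℝ[X]) {z : ℝ} (hz : 1 < z) :
    stieltjes α β (p + q) z = stieltjes α β p z + stieltjes α β q z := by
  unfold stieltjes
  rw [← integral_add (h.integrableOn_stieltjes p hz) (h.integrableOn_stieltjes q hz)]
  simp [add_mul]

lemma stieltjes_C_mul (c : ℝ) (p : ℝ[X]) (z : ℝ) :
    stieltjes α β (C c * p) z = c * stieltjes α β p z := by
  unfold stieltjes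
  rw [← integral_const_mul]
  simp [mul_assoc]

/-- Integrate x / (z - x) = z / (z - x) - 1 against p w. -/
lemma IsBranchPoints.stieltjes_X_mul (h : IsBranchPoints α β) (p : ℝ[X]) {z : ℝ} (hz : 1 < z) :
    stieltjes α β (X * p) z = z * stieltjes α β p z - mean α β p := by
  unfold stieltjes mean
  rw [← integral_const_mul, ← integral_sub ((h.integrableOn_stieltjes p hz).const_mul z)
    (h.integrableOn_mul_weight (by fun_prop))]
  refine setIntegral_congr_fun (measurableSet_E α β) fun x hx => ?_
  have := (h.E_subset hx).2
  have : z - x ≠ 0 := by linarith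
  simp only [eval_mul, eval_X]
  field_simp
  ring

/-- The Stieltjes transform of the weight is `√(∏ (z - α_j) / ((z² - 1) ∏ (z - β_j)))`. -/
lemma IsBranchPoints.stieltjes_one_sq (h : IsBranchPoints α β) {z : ℝ} (hz : 1 < z) :
    stieltjes α β 1 z ^ 2 * (denom β).eval z = (numer α).eval z := by
  have h1 := h.lintegral_weight_div hz
  have h2 : stieltjes α β 1 z = √((numer α).eval z / (denom β).eval z) := by
    have hi := h.integrableOn_stieltjes 1 hz
    have e : ∀ x, (1 : ℝ[X]).eval x * (z - x)⁻¹ * weight α β x = weight α β x / (z - x) := by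
      intro x
      rw [eval_one, one_mul, mul_comm, div_eq_mul_inv]
    simp only [e] at hi
    rw [← ofReal_integral_eq_lintegral_ofReal hi, ENNReal.ofReal_eq_ofReal_iff] at h1
    · simp only [stieltjes, e]
      exact h1
    · refine setIntegral_nonneg (measurableSet_E α β) fun x hx => ?_
      have := (h.E_subset hx).2
      exact div_nonneg (weight_nonneg α β x) (by linarith)
    · exact Real.sqrt_nonneg _
    · refine (ae_restrict_iff' (measurableSet_E α β)).mpr (Eventually.of_forall fun x hx => ?_)
      have := (h.E_subset hx).2
      exact div_nonneg (weight_nonneg α β x) (by linarith)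
  have hA : 0 < (numer α).eval z := by
    rw [eval_numer]
    exact (h.prod_sub_pos hz).1
  have hB : 0 < (denom β).eval z := by
    rw [eval_denom]
    exact mul_pos (by nlinarith) (h.prod_sub_pos hz).2
  rw [h2, Real.sq_sqrt (by positivity)]
  field_simp

lemma IsBranchPoints.tendsto_stieltjes (h : IsBranchPoints α β) (p : ℝ[X]) :
    Tendsto (stieltjes α β p) atTop (𝓝 0) := by
  set M := ∫ x in E α β, ‖p.eval x * weight α β x‖ with hM
  have hb : ∀ z : ℝ, 1 < z → ‖stieltjes α β p z‖ ≤ (z - 1)⁻¹ * M := by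
    intro z hz
    have hi : IntegrableOn (fun x => p.eval x * weight α β x) (E α β) :=
      h.integrableOn_mul_weight (by fun_prop)
    rw [hM, ← integral_const_mul]
    refine norm_integral_le_of_norm_le (hi.norm.const_mul _) ?_
    refine (ae_restrict_iff' (measurableSet_E α β)).mpr (Eventually.of_forall fun x hx => ?_)
    have hx1 := (h.E_subset hx).2
    have h1 : ‖(z - x)⁻¹‖ ≤ (z - 1)⁻¹ := by
      rw [Real.norm_of_nonneg (inv_nonneg.mpr (by linarith))]
      exact inv_anti₀ (by linarith) (by linarith)
    rw [mul_right_comm, norm_mul, mul_comm]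
    gcongr
  have hlim : Tendsto (fun z : ℝ => (z - 1)⁻¹ * M) atTop (𝓝 0) := by
    have h1 : Tendsto (fun z : ℝ => z - 1) atTop atTop :=
      tendsto_atTop_add_const_right _ _ tendsto_id
    simpa using h1.inv_tendsto_atTop.mul_const M
  refine squeeze_zero_norm' ?_ hlim
  filter_upwards [eventually_gt_atTop 1] with z hz using hb z hz

/-- If `p` is orthogonal to all polynomials of degree less than `n`, then
`z ^ n` times its Stieltjes transform tends to zero. -/
lemma IsBranchPoints.tendsto_pow_mul_stieltjes (h : IsBranchPoints α β) (n : ℕ) {p : ℝ[X]}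
    (hp : ∀ i < n, mean α β (X ^ i * p) = 0) :
    Tendsto (fun z => z ^ n * stieltjes α β p z) atTop (𝓝 0) := by
  -- Each multiplication by `X` costs a moment of `p`, which vanishes for the first `n` steps; thus
  -- z^n times the transform of p is the transform of X^n p.
  have key : ∀ m ≤ n, ∀ z : ℝ, 1 < z → stieltjes α β (X ^ m * p) z = z ^ m * stieltjes α β p z := by
    intro m
    induction m with
    | zero => intro _ z _; simp
    | succ m ih =>
      intro hm z hz
      rw [pow_succ', mul_assoc, h.stieltjes_X_mul _ hz, hp m (by omega), ih (by omega) z hz]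
      ring
  refine (h.tendsto_stieltjes (X ^ n * p)).congr' ?_
  filter_upwards [eventually_gt_atTop 1] with z hz using key n le_rfl z hz

/-- The mass is the limit of z ψ(z), and (z ψ)² = z² A / B tends to the ratio of leading
coefficients, 1. The mass is nonnegative, hence 1. -/
lemma IsBranchPoints.mean_one (h : IsBranchPoints α β) : mean α β 1 = 1 := by
  have h1 : Tendsto (fun z => z * stieltjes α β 1 z) atTop (𝓝 (mean α β 1)) := by
    have h0 := (h.tendsto_stieltjes (X * 1)).add_const (mean α β 1)
    rw [zero_add] at h0
    refine h0.congr' ?_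
    filter_upwards [eventually_gt_atTop 1] with z hz
    rw [h.stieltjes_X_mul _ hz]
    ring
  have hm : (X ^ 2 * numer α : ℝ[X]).Monic := (monic_X_pow 2).mul (monic_numer α)
  have hd : (X ^ 2 * numer α : ℝ[X]).degree = (denom β).degree := by
    rw [degree_eq_natDegree hm.ne_zero, degree_eq_natDegree (monic_denom β).ne_zero,
      natDegree_denom, (monic_X_pow 2).natDegree_mul (monic_numer α), natDegree_numer,
      natDegree_X_pow, add_comm]
  have h2 := div_tendsto_atTop_leadingCoeff_div_of_degree_eq _ _ hd
  rw [hm.leadingCoeff, (monic_denom β).leadingCoeff, div_one] at h2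
  have h3 : Tendsto (fun z => (z * stieltjes α β 1 z) ^ 2) atTop (𝓝 1) := by
    refine h2.congr' ?_
    filter_upwards [eventually_gt_atTop 1] with z hz
    have hB : 0 < (denom β).eval z := by
      rw [eval_denom]
      exact mul_pos (by nlinarith) (h.prod_sub_pos hz).2
    rw [eval_mul, eval_pow, eval_X, ← h.stieltjes_one_sq hz]
    field_simp
  have h4 := tendsto_nhds_unique (h1.pow 2) h3
  have h5 : 0 ≤ mean α β 1 := by
    unfold mean
    refine setIntegral_nonneg (measurableSet_E α β) fun x _ => ?_
    simpa using weight_nonneg α β x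
  nlinarith

lemma IsBranchPoints.weight_pos (h : IsBranchPoints α β) {k : Fin (g + 1)} {x : ℝ}
    (hx : x ∈ Set.Ioo (bandLeft β k) (bandRight α k)) : 0 < weight α β x := by
  rw [h.weight_eq hx]
  have h1 := h.lt_one_of_mem hx
  have h2 := Real.sqrt_pos.mpr (h.bandMap_pos hx)
  have h3 : 0 < 1 - x := by linarith
  have := Real.pi_pos
  positivity

lemma IsBranchPoints.mean_sq_pos (h : IsBranchPoints α β) {p : ℝ[X]} (hp : p ≠ 0) :
    0 < mean α β (p * p) := by
  unfold mean
  rw [setIntegral_pos_iff_support_of_nonneg_ae]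
  · set I := Set.Ioo (bandLeft β 0) (bandRight α 0) with hI
    have hsub : I \ (p.roots.toFinset : Set ℝ) ⊆
        (Function.support fun x => (p * p).eval x * weight α β x) ∩ E α β := by
      rintro x ⟨hx, hx'⟩
      refine ⟨?_, Set.mem_iUnion.mpr ⟨0, Set.Ioo_subset_Icc_self hx⟩⟩
      have h0 : p.eval x ≠ 0 := by
        intro h0
        exact hx' (by simpa [hp] using h0)
      rw [Function.mem_support, eval_mul]
      exact mul_ne_zero (mul_ne_zero h0 h0) (h.weight_pos hx).ne'
    refine lt_of_lt_of_le ?_ (measure_mono hsub)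
    rw [measure_sdiff_null (Finset.measure_zero _ _), hI, Real.volume_Ioo]
    simpa using h.band 0
  · refine Eventually.of_forall fun x => ?_
    simp only [Pi.zero_apply, eval_mul]
    exact mul_nonneg (mul_self_nonneg _) (weight_nonneg α β x)
  · exact h.integrableOn_mul_weight (by fun_prop)

/-! ### Orthogonality and the recurrence for the transforms ψₙ. -/

variable {P : ℕ → ℝ[X]} {a b : ℕ → ℝ}

/-- `P n` is orthogonal to every polynomial of degree less than `n`. -/
lemma IsMonicOrthogonal.mean_mul_eq_zero (hP : IsMonicOrthogonal α β P) (h : IsBranchPoints α β)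
    {n : ℕ} {q : ℝ[X]} (hq : q.degree < n) : mean α β (q * P n) = 0 := by
  have key : ∀ m : ℕ, ∀ q : ℝ[X], q.degree < m → m ≤ n → mean α β (q * P n) = 0 := by
    intro m
    induction m with
    | zero =>
      intro q hq _
      have : q = 0 := by
        rw [← degree_eq_bot]
        exact Nat.WithBot.lt_zero_iff.mp (by exact_mod_cast hq)
      simp [this, mean]
    | succ m ih =>
      intro q hq hm
      have hPd : (P m).degree = (m : WithBot ℕ) := by
        rw [degree_eq_natDegree (hP.monic m).ne_zero, hP.natDegree_eq]
      -- Removing the top coefficient by a multiple of `P m` leaves a polynomial covered by the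
      -- induction hypothesis.
      have hlt : (q - C (q.coeff m) * P m).degree < m := by
        rw [degree_lt_iff_coeff_zero]
        intro i hi
        rcases hi.eq_or_lt with rfl | hi
        · have : (P m).coeff m = 1 := by
            have := (hP.monic m).coeff_natDegree
            rwa [hP.natDegree_eq] at this
          simp [this]
        · have h1 : q.coeff i = 0 := (degree_lt_iff_coeff_zero q (m + 1)).mp hq i hi
          have h2 : (P m).coeff i = 0 :=
            coeff_eq_zero_of_natDegree_lt (by rw [hP.natDegree_eq]; exact hi)
          simp [h1, h2]
      have e : q * P n = (q - C (q.coeff m) * P m) * P n + C (q.coeff m) * (P m * P n) := by ring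
      rw [e, h.mean_add, ih _ hlt (by omega), mean_C_mul, ← pairing_eq_mean,
        hP.orthogonal m n (by omega)]
      simp
  exact key n q hq le_rfl

lemma IsMonicOrthogonal.mean_eq_zero (hP : IsMonicOrthogonal α β P) (h : IsBranchPoints α β)
    {n : ℕ} (hn : 0 < n) : mean α β (P n) = 0 := by
  have := hP.mean_mul_eq_zero h (n := n) (q := 1) (by
    rw [degree_one]; exact_mod_cast hn)
  rwa [one_mul] at this

lemma IsMonicOrthogonal.pairing_pos (hP : IsMonicOrthogonal α β P) (h : IsBranchPoints α β)
    (n : ℕ) : 0 < pairing α β (P n) (P n) := by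
  rw [pairing_eq_mean]
  exact h.mean_sq_pos (hP.monic n).ne_zero

lemma IsMonicOrthogonal.eq_one (hP : IsMonicOrthogonal α β P) : P 0 = 1 :=
  (hP.monic 0).natDegree_eq_zero.mp (hP.natDegree_eq 0)

/-- `hₙ₊₁ = aₙ₊₁ hₙ`. -/
lemma IsRecurrence.pairing_succ (hab : IsRecurrence P a b) (hP : IsMonicOrthogonal α β P)
    (h : IsBranchPoints α β) (n : ℕ) :
    pairing α β (P (n + 1)) (P (n + 1)) = a (n + 1) * pairing α β (P n) (P n) := by
  have hlt : (P (n + 1) - X * P n).degree < ((n + 1 : ℕ) : WithBot ℕ) := by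
    have hd : (P (n + 1)).degree = ((n + 1 : ℕ) : WithBot ℕ) := by
      rw [degree_eq_natDegree (hP.monic _).ne_zero, hP.natDegree_eq]
    have hm : (X * P n).Monic := monic_X.mul (hP.monic n)
    have hd' : (X * P n).degree = ((n + 1 : ℕ) : WithBot ℕ) := by
      rw [degree_eq_natDegree hm.ne_zero, monic_X.natDegree_mul (hP.monic n), natDegree_X,
        hP.natDegree_eq, add_comm]
    rw [← hd]
    exact degree_sub_lt_left (by rw [hd, hd']) (hP.monic _).ne_zero
      (by rw [(hP.monic _).leadingCoeff, hm.leadingCoeff])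
  have h1 := hP.mean_mul_eq_zero h hlt
  have e1 : P (n + 1) * P (n + 1) =
      (P (n + 1) - X * P n) * P (n + 1) + P n * (X * P (n + 1)) := by ring
  have e2 : P n * (X * P (n + 1)) = P n * P (n + 2) +
      (C (b (n + 2)) * (P n * P (n + 1)) + C (a (n + 1)) * (P n * P n)) := by
    rw [hab.succ n]
    ring
  rw [pairing_eq_mean, e1, h.mean_add, h1, e2, h.mean_add, h.mean_add, mean_C_mul, mean_C_mul,
    ← pairing_eq_mean, ← pairing_eq_mean, ← pairing_eq_mean, hP.orthogonal n (n + 2) (by omega),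
    hP.orthogonal n (n + 1) (by omega)]
  ring

lemma IsRecurrence.a_pos (hab : IsRecurrence P a b) (hP : IsMonicOrthogonal α β P)
    (h : IsBranchPoints α β) (n : ℕ) : 0 < a (n + 1) := by
  have h1 := hP.pairing_pos h n
  have h2 := hP.pairing_pos h (n + 1)
  rw [hab.pairing_succ hP h] at h2
  exact pos_of_mul_pos_left h2 h1.le

lemma IsMonicOrthogonal.tendsto_pow_mul_stieltjes (hP : IsMonicOrthogonal α β P)
    (h : IsBranchPoints α β) {m n : ℕ} (hmn : m ≤ n) :
    Tendsto (fun z => z ^ m * stieltjes α β (P n) z) atTop (𝓝 0) := by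
  refine h.tendsto_pow_mul_stieltjes m fun i hi => hP.mean_mul_eq_zero h ?_
  rw [degree_X_pow]
  exact_mod_cast hi.trans_le hmn

lemma IsRecurrence.stieltjes_succ (hab : IsRecurrence P a b) (hP : IsMonicOrthogonal α β P)
    (h : IsBranchPoints α β) (n : ℕ) {z : ℝ} (hz : 1 < z) :
    stieltjes α β (P (n + 2)) z =
      (z - b (n + 2)) * stieltjes α β (P (n + 1)) z - a (n + 1) * stieltjes α β (P n) z := by
  have h1 := h.stieltjes_X_mul (P (n + 1)) hz
  rw [hP.mean_eq_zero h (Nat.succ_pos n), hab.succ n, h.stieltjes_add _ _ hz,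
    h.stieltjes_add _ _ hz, stieltjes_C_mul, stieltjes_C_mul] at h1
  linarith

lemma IsRecurrence.stieltjes_one_eq (hab : IsRecurrence P a b) (hP : IsMonicOrthogonal α β P)
    (h : IsBranchPoints α β) {z : ℝ} (hz : 1 < z) :
    stieltjes α β (P 1) z = (z - b 1) * stieltjes α β 1 z - 1 := by
  have h1 := h.stieltjes_X_mul (P 0) hz
  rw [hab.zero, hP.eq_one, h.mean_one, h.stieltjes_add _ _ hz, stieltjes_C_mul] at h1
  linarith

end GenChebyshev
end

/-! ### Polynomials of the second kind and the algebraic consequences of periodicity. -/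

noncomputable section
namespace GenChebyshev

open Filter Topology

variable {g : ℕ} {α β : Fin g → ℝ} {P : ℕ → ℝ[X]} {a b : ℕ → ℝ} {K : ℕ}

/-- The polynomials of the second kind: the solution of the recurrence with initial values
`0` and `1`. -/
def secondKind (a b : ℕ → ℝ) : ℕ → ℝ[X]
  | 0 => 0
  | 1 => 1
  | n + 2 => (X - C (b (n + 2))) * secondKind a b (n + 1) - C (a (n + 1)) * secondKind a b n

lemma secondKind_zero (a b : ℕ → ℝ) : secondKind a b 0 = 0 := rfl

lemma secondKind_one (a b : ℕ → ℝ) : secondKind a b 1 = 1 := rfl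

lemma secondKind_add_two (a b : ℕ → ℝ) (n : ℕ) : secondKind a b (n + 2) =
    (X - C (b (n + 2))) * secondKind a b (n + 1) - C (a (n + 1)) * secondKind a b n := rfl

lemma monic_natDegree_secondKind (a b : ℕ → ℝ) (n : ℕ) :
    (secondKind a b (n + 1)).Monic ∧ (secondKind a b (n + 1)).natDegree = n := by
  induction n using Nat.twoStepInduction with
  | zero => simp [secondKind_one]
  | one =>
    simp only [secondKind_add_two, secondKind_zero, secondKind_one, mul_one, mul_zero, sub_zero,
      zero_add]
    exact ⟨monic_X_sub_C _, natDegree_X_sub_C _⟩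
  | more n ih1 ih2 =>
    rw [secondKind_add_two]
    have hm : ((X - C (b (n + 1 + 2))) * secondKind a b (n + 1 + 1)).Monic :=
      (monic_X_sub_C _).mul ih2.1
    have hn : ((X - C (b (n + 1 + 2))) * secondKind a b (n + 1 + 1)).natDegree = n + 2 := by
      rw [(monic_X_sub_C _).natDegree_mul ih2.1, natDegree_X_sub_C, ih2.2]
      ring
    have hlt : (C (a (n + 1 + 1)) * secondKind a b (n + 1)).natDegree < n + 2 := by
      refine (natDegree_C_mul_le _ _).trans_lt ?_
      rw [ih1.2]
      omega
    have hdlt : (C (a (n + 1 + 1)) * secondKind a b (n + 1)).degree <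
        ((X - C (b (n + 1 + 2))) * secondKind a b (n + 1 + 1)).degree :=
      degree_lt_degree (by rw [hn]; exact hlt)
    refine ⟨hm.sub_of_left hdlt, ?_⟩
    rw [natDegree_sub_eq_left_of_natDegree_lt (by rw [hn]; exact hlt), hn]

lemma IsRecurrence.add_two (hab : IsRecurrence P a b) (n : ℕ) :
    P (n + 2) = (X - C (b (n + 2))) * P (n + 1) - C (a (n + 1)) * P n := by
  linear_combination -hab.succ n

lemma IsRecurrence.one_eq (hab : IsRecurrence P a b) (hP : IsMonicOrthogonal α β P) :
    P 1 = X - C (b 1) := by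
  have := hab.zero
  rw [hP.eq_one] at this
  linear_combination -this

/-- The Casoratian of the polynomials of the first and the second kind. -/
lemma IsRecurrence.casoratian (hab : IsRecurrence P a b) (hP : IsMonicOrthogonal α β P)
    (h : IsBranchPoints α β) (n : ℕ) :
    P n * secondKind a b (n + 1) - P (n + 1) * secondKind a b n =
      C (pairing α β (P n) (P n)) := by
  induction n with
  | zero =>
    rw [secondKind_one, secondKind_zero, hP.eq_one, pairing_eq_mean, mul_one, h.mean_one]
    simp
  | succ n ih =>
    rw [hab.pairing_succ hP h, C_mul, ← ih, secondKind_add_two, hab.add_two]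
    ring

/-- Both sides solve the same recurrence. The normalization Q₁ = 1 matches the total mass 1 of the
weight, which enters the step from ψ₀ to ψ₁. -/
lemma IsRecurrence.stieltjes_eq (hab : IsRecurrence P a b) (hP : IsMonicOrthogonal α β P)
    (h : IsBranchPoints α β) (n : ℕ) {z : ℝ} (hz : 1 < z) :
    stieltjes α β (P n) z = (P n).eval z * stieltjes α β 1 z - (secondKind a b n).eval z := by
  induction n using Nat.twoStepInduction with
  | zero => simp [hP.eq_one, secondKind_zero]
  | one =>
    rw [hab.stieltjes_one_eq hP h hz, hab.one_eq hP, secondKind_one]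
    simp
  | more n ih1 ih2 =>
    rw [hab.stieltjes_succ hP h n hz, ih1, ih2, hab.add_two, secondKind_add_two]
    simp only [eval_sub, eval_mul, eval_X, eval_C]
    ring

lemma tendsto_eval_mul_of_forall_pow {f : ℝ → ℝ}
    (hf : ∀ n : ℕ, Tendsto (fun z => z ^ n * f z) atTop (𝓝 0)) (r : ℝ[X]) :
    Tendsto (fun z => r.eval z * f z) atTop (𝓝 0) := by
  have : (fun z => r.eval z * f z) =
      fun z => ∑ i ∈ Finset.range (r.natDegree + 1), r.coeff i * (z ^ i * f z) := by
    funext z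
    rw [eval_eq_sum_range, Finset.sum_mul]
    exact Finset.sum_congr rfl fun i _ => by ring
  rw [this]
  simpa using tendsto_finsetSum (Finset.range (r.natDegree + 1))
    fun i _ => (hf i).const_mul (r.coeff i)

lemma denom_eq (β : Fin g → ℝ) : denom β = (X - C 1) * leftNodal β := by
  rw [denom, leftNodal, numer, C_neg, C_1]
  ring

/-- `denom / numer` is not the square of a rational function. -/
lemma IsBranchPoints.eq_zero_of_sq_mul_denom_eq (h : IsBranchPoints α β) {p q : ℝ[X]}
    (hpq : p ^ 2 * denom β = q ^ 2 * numer α) : p = 0 ∧ q = 0 := by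
  have hA0 := (monic_numer α).ne_zero
  have hB0 := (monic_denom β).ne_zero
  by_cases hp : p = 0
  · refine ⟨hp, ?_⟩
    rw [hp, zero_pow two_ne_zero, zero_mul] at hpq
    exact pow_eq_zero_iff two_ne_zero |>.mp ((mul_eq_zero.mp hpq.symm).resolve_right hA0)
  exfalso
  have hq : q ≠ 0 := by
    rintro rfl
    rw [zero_pow two_ne_zero, zero_mul] at hpq
    exact (mul_ne_zero (pow_ne_zero 2 hp) hB0) hpq
  have hL : (leftNodal β).rootMultiplicity 1 = 0 := by
    refine rootMultiplicity_eq_zero ?_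
    rw [IsRoot.def, eval_leftNodal]
    refine mul_ne_zero (by norm_num) (Finset.prod_ne_zero_iff.mpr fun j _ => ?_)
    linarith [h.lt_one j]
  have hA : (numer α).rootMultiplicity 1 = 0 := by
    refine rootMultiplicity_eq_zero ?_
    rw [IsRoot.def, eval_numer]
    refine Finset.prod_ne_zero_iff.mpr fun j _ => ?_
    linarith [h.lt_one j, h.gap j]
  have hB : (denom β).rootMultiplicity 1 = 1 := by
    rw [denom_eq, rootMultiplicity_mul (by rw [← denom_eq]; exact hB0), hL,
      rootMultiplicity_X_sub_C_self]
  -- The root 1 has odd multiplicity on the left and even multiplicity on the right.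
  have h1 := congrArg (rootMultiplicity 1) hpq
  rw [rootMultiplicity_mul (mul_ne_zero (pow_ne_zero 2 hp) hB0),
    rootMultiplicity_mul (mul_ne_zero (pow_ne_zero 2 hq) hA0), sq, sq,
    rootMultiplicity_mul (mul_ne_zero hp hp), rootMultiplicity_mul (mul_ne_zero hq hq),
    hA, hB] at h1
  omega

/-- Asymptotic independence of `1` and the Stieltjes transform of the weight over polynomials. -/
lemma IsBranchPoints.eq_zero_of_tendsto (h : IsBranchPoints α β) {p q : ℝ[X]}
    (hpq : ∀ n : ℕ, Tendsto (fun z => z ^ n * (p.eval z + q.eval z * stieltjes α β 1 z)) atTop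
      (𝓝 0)) : p = 0 ∧ q = 0 := by
  -- Multiplying p + q ψ by B (p - q ψ) gives the polynomial B p² - A q²; it tends to zero at
  -- infinity, so it is zero.
  have h1 := tendsto_eval_mul_of_forall_pow hpq (denom β * p)
  have h2 := (tendsto_eval_mul_of_forall_pow hpq (denom β * q)).mul (h.tendsto_stieltjes 1)
  have h3 := h1.sub h2
  rw [mul_zero, sub_zero] at h3
  have h4 : Tendsto (fun z => (p ^ 2 * denom β - q ^ 2 * numer α).eval z) atTop (𝓝 0) := by
    refine h3.congr' ?_
    filter_upwards [eventually_gt_atTop 1] with z hz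
    simp only [eval_sub, eval_mul, eval_pow]
    rw [← h.stieltjes_one_sq hz]
    ring
  rw [Polynomial.tendsto_nhds_iff] at h4
  exact h.eq_zero_of_sq_mul_denom_eq (sub_eq_zero.mp (leadingCoeff_eq_zero.mp h4.1))

/-- The expression is the Casoratian of ψₙ and ψₙ₊ₖ (shift by `K`) at its lowest position, rewritten
through the recurrence. The two coefficients `a 1` and `a (K + 1)` are kept apart because
periodicity of `a` only starts at index 2. -/
lemma IsRecurrence.tendsto_pow_mul_casoratian (hab : IsRecurrence P a b)
    (hP : IsMonicOrthogonal α β P) (h : IsBranchPoints α β) (hK : HasPeriod a b K) (n : ℕ) :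
    Tendsto (fun z => z ^ n * (a 1 * stieltjes α β (P 0) z * stieltjes α β (P (K + 1)) z -
      a (K + 1) * stieltjes α β (P K) z * stieltjes α β (P 1) z)) atTop (𝓝 0) := by
  set ψ : ℕ → ℝ → ℝ := fun n => stieltjes α β (P n) with hψ
  -- Moving up one index multiplies the Casoratian by a positive recurrence coefficient; at high
  -- index its factors decay as fast as desired.
  have hstep : ∀ n, ∃ k : ℝ, 0 < k ∧ ∀ z : ℝ, 1 < z →
      ψ (n + 1 + K + 1) z * ψ (n + 1) z - ψ (n + 1 + K) z * ψ (n + 2) z =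
        k * (a 1 * ψ 0 z * ψ (K + 1) z - a (K + 1) * ψ K z * ψ 1 z) := by
    intro n
    induction n with
    | zero =>
      refine ⟨1, one_pos, fun z hz => ?_⟩
      have e1 := hab.stieltjes_succ hP h K hz
      have e2 := hab.stieltjes_succ hP h 0 hz
      have hb := hK.b_periodic 2 (by norm_num)
      rw [show 0 + 1 + K + 1 = K + 2 by ring, show 0 + 1 + K = K + 1 by ring]
      rw [add_comm 2 K] at hb
      rw [hb] at e1
      simp only [hψ, zero_add] at e2 ⊢
      rw [e1, e2]
      ring
    | succ n ih =>
      obtain ⟨k, hk, ih⟩ := ih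
      refine ⟨a (n + 2) * k, mul_pos (hab.a_pos hP h (n + 1)) hk, fun z hz => ?_⟩
      have e1 := hab.stieltjes_succ hP h (n + 1 + K) hz
      have e2 := hab.stieltjes_succ hP h (n + 1) hz
      have hb := hK.b_periodic (n + 1 + 2) (by omega)
      have ha := hK.a_periodic (n + 2) (by omega)
      rw [show n + 1 + K + 2 = n + 1 + 2 + K by ring, hb,
        show n + 1 + K + 1 = n + 2 + K by ring, ha] at e1
      have ih' := ih z hz
      rw [show n + 1 + K + 1 = n + 2 + K by ring] at ih'
      rw [show n + 1 + 1 + K + 1 = n + 1 + 2 + K by ring, show n + 1 + 1 + K = n + 2 + K by ring,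
        mul_assoc, ← ih']
      simp only [hψ] at e1 e2 ⊢
      rw [e1, e2]
      ring_nf
  obtain ⟨k, hk, hkz⟩ := hstep n
  have t1 := (hP.tendsto_pow_mul_stieltjes h (show n ≤ n + 1 + K + 1 by omega)).mul
    (h.tendsto_stieltjes (P (n + 1)))
  have t2 := (hP.tendsto_pow_mul_stieltjes h (show n ≤ n + 1 + K by omega)).mul
    (h.tendsto_stieltjes (P (n + 2)))
  have t3 := (t1.sub t2).const_mul k⁻¹
  simp only [mul_zero, sub_zero] at t3
  refine t3.congr' ?_
  filter_upwards [eventually_gt_atTop 1] with z hz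
  have e := hkz z hz
  simp only [hψ] at e
  have e' : a 1 * stieltjes α β (P 0) z * stieltjes α β (P (K + 1)) z -
      a (K + 1) * stieltjes α β (P K) z * stieltjes α β (P 1) z =
      k⁻¹ * (stieltjes α β (P (n + 1 + K + 1)) z * stieltjes α β (P (n + 1)) z -
        stieltjes α β (P (n + 1 + K)) z * stieltjes α β (P (n + 2)) z) := by
    rw [e, inv_mul_cancel_left₀ hk.ne']
  rw [e']
  ring

/-- Insert ψₙ = Pₙ ψ - Qₙ in the rapidly decaying Casoratian, multiply by B and replace B ψ² by A.
The result is p + q ψ, so both polynomials vanish. -/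
lemma IsRecurrence.period_relations (hab : IsRecurrence P a b)
    (hP : IsMonicOrthogonal α β P) (h : IsBranchPoints α β) (hK : HasPeriod a b K) :
    C (a (K + 1)) * (denom β * secondKind a b K) =
        numer α * (C (a 1) * P (K + 1) - C (a (K + 1)) * (P 1 * P K)) ∧
      C (a 1) * secondKind a b (K + 1) = C (a (K + 1)) * (P K + P 1 * secondKind a b K) := by
  set Q := secondKind a b with hQ
  have key := h.eq_zero_of_tendsto
    (p := numer α * (C (a 1) * P (K + 1) - C (a (K + 1)) * (P 1 * P K)) -
      C (a (K + 1)) * (denom β * Q K))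
    (q := denom β * (C (a (K + 1)) * (P K + P 1 * Q K) - C (a 1) * Q (K + 1))) ?_
  · refine ⟨(sub_eq_zero.mp key.1).symm, ?_⟩
    exact (sub_eq_zero.mp
      ((mul_eq_zero.mp key.2).resolve_left (monic_denom β).ne_zero)).symm
  · intro n
    have hm : ∀ m : ℕ, Tendsto (fun z => z ^ m * (z ^ n *
        (a 1 * stieltjes α β (P 0) z * stieltjes α β (P (K + 1)) z -
          a (K + 1) * stieltjes α β (P K) z * stieltjes α β (P 1) z))) atTop (𝓝 0) := by
      intro m
      refine (hab.tendsto_pow_mul_casoratian hP h hK (m + n)).congr fun z => ?_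
      rw [pow_add]
      ring
    refine (tendsto_eval_mul_of_forall_pow hm (denom β)).congr' ?_
    filter_upwards [eventually_gt_atTop 1] with z hz
    rw [hab.stieltjes_eq hP h (K + 1) hz, hab.stieltjes_eq hP h K hz,
      hab.stieltjes_eq hP h 1 hz, hP.eq_one, secondKind_one]
    simp only [eval_sub, eval_mul, eval_add, eval_C, eval_one, ← hQ]
    rw [← h.stieltjes_one_sq hz]
    ring

/-- Compare the coefficients of degree g + K + 1 in the first period relation: a_{K+1} = a₁ -
a_{K+1}. -/
lemma IsRecurrence.a_one_eq (hab : IsRecurrence P a b)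
    (hP : IsMonicOrthogonal α β P) (h : IsBranchPoints α β) (hK : HasPeriod a b K) :
    a 1 = 2 * a (K + 1) := by
  have h1 := (hab.period_relations hP h hK).1
  obtain ⟨k, rfl⟩ : ∃ k, K = k + 1 := ⟨K - 1, by have := hK.pos; omega⟩
  obtain ⟨hQm, hQd⟩ := monic_natDegree_secondKind a b k
  have e1 : ∀ p : ℝ[X], p.Monic → p.natDegree = g + k + 2 → p.coeff (g + k + 2) = 1 := by
    intro p hp hd
    rw [← hd]
    exact hp.coeff_natDegree
  have c1 := e1 (denom β * secondKind a b (k + 1)) ((monic_denom β).mul hQm) (by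
    rw [(monic_denom β).natDegree_mul hQm, natDegree_denom, hQd]; ring)
  have c2 := e1 (numer α * P (k + 1 + 1)) ((monic_numer α).mul (hP.monic _)) (by
    rw [(monic_numer α).natDegree_mul (hP.monic _), natDegree_numer, hP.natDegree_eq]; ring)
  have c3 := e1 (numer α * (P 1 * P (k + 1)))
    ((monic_numer α).mul ((hP.monic _).mul (hP.monic _))) (by
    rw [(monic_numer α).natDegree_mul ((hP.monic _).mul (hP.monic _)),
      (hP.monic _).natDegree_mul (hP.monic _), natDegree_numer, hP.natDegree_eq,
      hP.natDegree_eq]; ring)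
  have e2 : numer α * (C (a 1) * P (k + 1 + 1) - C (a (k + 1 + 1)) * (P 1 * P (k + 1))) =
      C (a 1) * (numer α * P (k + 1 + 1)) -
        C (a (k + 1 + 1)) * (numer α * (P 1 * P (k + 1))) := by ring
  rw [e2] at h1
  have h2 := congrArg (fun p : ℝ[X] => p.coeff (g + k + 2)) h1
  simp only [coeff_sub, coeff_C_mul, c1, c2, c3] at h2
  linarith

lemma IsBranchPoints.ne (h : IsBranchPoints α β) (i j : Fin g) : α i ≠ β j := by
  rcases le_or_gt i j with hij | hij
  · have h1 := h.bandRight_le (k := i.castSucc) (j := j) (by simpa using hij)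
    rw [bandRight_castSucc] at h1
    exact (h1.trans_lt (h.gap j)).ne
  · have h1 := h.le_bandLeft (k := i.castSucc) (j := j) (by simpa using hij)
    have h2 := h.band i.castSucc
    rw [bandRight_castSucc] at h2
    exact (h1.trans_lt h2).ne'

lemma isCoprime_X_sub_C_of_ne {x y : ℝ} (hxy : x ≠ y) : IsCoprime (X - C x) (X - C y) :=
  isCoprime_X_sub_C_of_isUnit_sub (sub_ne_zero.mpr hxy).isUnit

lemma IsBranchPoints.isCoprime (h : IsBranchPoints α β) : IsCoprime (numer α) (denom β) := by
  refine IsCoprime.prod_left fun i _ => ?_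
  rw [denom_eq, leftNodal]
  have h1 := h.neg_one_lt i
  have h2 := h.gap i
  have h3 := h.lt_one i
  exact (isCoprime_X_sub_C_of_ne (by linarith)).mul_right
    ((isCoprime_X_sub_C_of_ne (by linarith)).mul_right
      (IsCoprime.prod_right fun j _ => isCoprime_X_sub_C_of_ne (h.ne i j)))

/-- The structure of `P K` and of the `K`-th polynomial of the second kind when the recurrence
coefficients have period `K`. -/
lemma IsRecurrence.exists_cofactor (hab : IsRecurrence P a b)
    (hP : IsMonicOrthogonal α β P) (h : IsBranchPoints α β) (hK : HasPeriod a b K) :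
    ∃ S : ℝ[X], secondKind a b K = numer α * S ∧ 2 * P (K + 1) = P K * P 1 + denom β * S ∧
      2 * secondKind a b (K + 1) = P K + secondKind a b K * P 1 := by
  obtain ⟨h1, h2⟩ := hab.period_relations hP h hK
  have ha := (hab.a_pos hP h K).ne'
  rw [hab.a_one_eq hP h hK, C_mul] at h1 h2
  have hC : (C (a (K + 1)) : ℝ[X]) ≠ 0 := C_ne_zero.mpr ha
  have h1' : denom β * secondKind a b K = numer α * (2 * P (K + 1) - P 1 * P K) := by
    refine mul_left_cancel₀ hC ?_
    rw [h1]
    simp only [map_ofNat]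
    ring
  have h2' : 2 * secondKind a b (K + 1) = P K + secondKind a b K * P 1 := by
    refine mul_left_cancel₀ hC ?_
    simp only [map_ofNat] at h2
    linear_combination h2
  -- A divides B Q_K and is coprime to B.
  obtain ⟨S, hS⟩ : numer α ∣ secondKind a b K :=
    h.isCoprime.dvd_of_dvd_mul_left (Dvd.intro _ h1'.symm)
  refine ⟨S, hS, ?_, h2'⟩
  have : denom β * S = 2 * P (K + 1) - P 1 * P K := by
    refine mul_left_cancel₀ (monic_numer α).ne_zero ?_
    rw [← h1', hS]
    ring
  rw [this]
  ring

/-- Pell's equation. -/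
lemma IsRecurrence.pell (hab : IsRecurrence P a b) (hP : IsMonicOrthogonal α β P)
    (h : IsBranchPoints α β) {S : ℝ[X]} (hS : secondKind a b K = numer α * S)
    (hS1 : 2 * P (K + 1) = P K * P 1 + denom β * S)
    (hS2 : 2 * secondKind a b (K + 1) = P K + secondKind a b K * P 1) :
    P K ^ 2 - numer α * denom β * S ^ 2 = C (2 * pairing α β (P K) (P K)) := by
  rw [C_mul, ← hab.casoratian hP h K]
  simp only [map_ofNat]
  linear_combination (-P K) * hS2 + secondKind a b K * hS1 + denom β * S * hS

/-- The addition formulas. -/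
lemma IsRecurrence.add_period (hab : IsRecurrence P a b) (hP : IsMonicOrthogonal α β P)
    (h : IsBranchPoints α β) (hK : HasPeriod a b K) {G : ℝ[X]}
    (h1 : 2 * P (K + 1) = P K * P 1 + G)
    (h2 : 2 * secondKind a b (K + 1) = P K + secondKind a b K * P 1) (n : ℕ) :
    2 * P (n + 1 + K) = P K * P (n + 1) + G * secondKind a b (n + 1) ∧
      2 * secondKind a b (n + 1 + K) =
        P K * secondKind a b (n + 1) + secondKind a b K * P (n + 1) := by
  induction n using Nat.twoStepInduction with
  | zero =>
    rw [zero_add, add_comm 1 K, secondKind_one, mul_one, mul_one]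
    exact ⟨h1, h2⟩
  | one =>
    -- This second starting value is where the exceptional coefficient enters: the left side
    -- produces 2 a_{K+1}, the right side a₁. From then on both sides follow the same recurrence.
    have hb := hK.b_periodic 2 (by norm_num)
    have ha : (2 * C (a (K + 1)) : ℝ[X]) = C (a 1) := by
      rw [hab.a_one_eq hP h hK, C_mul]
      simp only [map_ofNat]
    have e1 := hab.add_two K
    have e2 := secondKind_add_two a b K
    have e3 := hab.add_two 0
    have e4 := secondKind_add_two a b 0
    rw [add_comm 2 K] at hb
    rw [hb] at e1 e2
    simp only [zero_add, hP.eq_one, secondKind_zero, secondKind_one] at e3 e4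
    rw [show 1 + 1 + K = K + 2 by ring, show 1 + 1 = 2 from rfl, e1, e2, e3, e4]
    constructor
    · linear_combination (X - C (b 2)) * h1 - P K * ha
    · linear_combination (X - C (b 2)) * h2 - secondKind a b K * ha
  | more n ih1 ih2 =>
    have hb := hK.b_periodic (n + 1 + 2) (by omega)
    have ha := hK.a_periodic (n + 1 + 1) (by omega)
    have e1 := hab.add_two (n + 1 + K)
    have e2 := secondKind_add_two a b (n + 1 + K)
    have e3 := hab.add_two (n + 1)
    have e4 := secondKind_add_two a b (n + 1)
    rw [show n + 1 + K + 2 = n + 1 + 2 + K by ring, show n + 1 + K + 1 = n + 1 + 1 + K by ring,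
      hb, ha] at e1 e2
    rw [show n + 2 + 1 + K = n + 1 + 2 + K by ring, show n + 2 + 1 = n + 1 + 2 by ring, e1, e2,
      e3, e4]
    constructor
    · linear_combination (X - C (b (n + 1 + 2))) * ih2.1 - C (a (n + 1 + 1)) * ih1.1
    · linear_combination (X - C (b (n + 1 + 2))) * ih2.2 - C (a (n + 1 + 1)) * ih1.2

end GenChebyshev
end

/-! ### Monotonicity on the line and sign of imaginary parts in the upper half plane. -/

noncomputable section
namespace GenChebyshev

open ComplexConjugate

variable {g : ℕ} {α β : Fin g → ℝ} {P : ℕ → ℝ[X]} {a b : ℕ → ℝ} {K : ℕ}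

/-- The confluent Christoffel–Darboux formula. -/
lemma eval_wronskian_succ {y : ℕ → ℝ[X]}
    (hy : ∀ n, y (n + 2) = (X - C (b (n + 2))) * y (n + 1) - C (a (n + 1)) * y n) (x : ℝ) (n : ℕ) :
    (y (n + 2)).derivative.eval x * (y (n + 1)).eval x -
        (y (n + 2)).eval x * (y (n + 1)).derivative.eval x =
      (y (n + 1)).eval x ^ 2 + a (n + 1) * ((y (n + 1)).derivative.eval x * (y n).eval x -
        (y (n + 1)).eval x * (y n).derivative.eval x) := by
  rw [hy]
  simp only [derivative_sub, derivative_mul, derivative_X, derivative_C, eval_sub, eval_add,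
    eval_mul, eval_X, eval_C, eval_one, eval_zero]
  ring

/-- Each step adds a square and multiplies by a positive coefficient, so the initial sign persists.
The weak version serves the second kind polynomials, whose initial Wronskian is zero; the strict one
serves `P`. -/
lemma eval_wronskian_nonneg {y : ℕ → ℝ[X]}
    (hy : ∀ n, y (n + 2) = (X - C (b (n + 2))) * y (n + 1) - C (a (n + 1)) * y n)
    (ha : ∀ n, 0 < a (n + 1)) (x : ℝ)
    (h0 : 0 ≤ (y 1).derivative.eval x * (y 0).eval x - (y 1).eval x * (y 0).derivative.eval x)
    (n : ℕ) :
    0 ≤ (y (n + 1)).derivative.eval x * (y n).eval x -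
      (y (n + 1)).eval x * (y n).derivative.eval x := by
  induction n with
  | zero => exact h0
  | succ n ih =>
    rw [eval_wronskian_succ hy]
    have := mul_nonneg (ha n).le ih
    positivity

lemma eval_wronskian_pos {y : ℕ → ℝ[X]}
    (hy : ∀ n, y (n + 2) = (X - C (b (n + 2))) * y (n + 1) - C (a (n + 1)) * y n)
    (ha : ∀ n, 0 < a (n + 1)) (x : ℝ)
    (h0 : 0 < (y 1).derivative.eval x * (y 0).eval x - (y 1).eval x * (y 0).derivative.eval x)
    (n : ℕ) :
    0 < (y (n + 1)).derivative.eval x * (y n).eval x -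
      (y (n + 1)).eval x * (y n).derivative.eval x := by
  induction n with
  | zero => exact h0
  | succ n ih =>
    rw [eval_wronskian_succ hy]
    have := mul_pos (ha n) ih
    positivity

/-- The analogue of Christoffel–Darboux for z and its conjugate; it propagates positivity in the
upper half plane. -/
lemma im_aeval_mul_conj_succ {y : ℕ → ℝ[X]}
    (hy : ∀ n, y (n + 2) = (X - C (b (n + 2))) * y (n + 1) - C (a (n + 1)) * y n) (z : ℂ) (n : ℕ) :
    (aeval z (y (n + 2)) * conj (aeval z (y (n + 1)))).im =
      z.im * Complex.normSq (aeval z (y (n + 1))) +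
        a (n + 1) * (aeval z (y (n + 1)) * conj (aeval z (y n))).im := by
  rw [hy]
  simp only [map_sub, map_mul, aeval_X, aeval_C, Complex.coe_algebraMap, Complex.mul_im,
    Complex.sub_re, Complex.sub_im, Complex.mul_re, Complex.ofReal_re, Complex.ofReal_im,
    Complex.conj_re, Complex.conj_im, Complex.normSq_apply]
  ring

lemma im_aeval_mul_conj_nonneg {y : ℕ → ℝ[X]}
    (hy : ∀ n, y (n + 2) = (X - C (b (n + 2))) * y (n + 1) - C (a (n + 1)) * y n)
    (ha : ∀ n, 0 < a (n + 1)) {z : ℂ} (hz : 0 < z.im)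
    (h0 : 0 ≤ (aeval z (y 1) * conj (aeval z (y 0))).im) (n : ℕ) :
    0 ≤ (aeval z (y (n + 1)) * conj (aeval z (y n))).im := by
  induction n with
  | zero => exact h0
  | succ n ih =>
    rw [im_aeval_mul_conj_succ hy]
    exact add_nonneg (mul_nonneg hz.le (Complex.normSq_nonneg _)) (mul_nonneg (ha n).le ih)

lemma im_aeval_mul_conj_pos {y : ℕ → ℝ[X]}
    (hy : ∀ n, y (n + 2) = (X - C (b (n + 2))) * y (n + 1) - C (a (n + 1)) * y n)
    (ha : ∀ n, 0 < a (n + 1)) {z : ℂ} (hz : 0 < z.im)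
    (h0 : 0 < (aeval z (y 1) * conj (aeval z (y 0))).im) (n : ℕ) :
    0 < (aeval z (y (n + 1)) * conj (aeval z (y n))).im := by
  induction n with
  | zero => exact h0
  | succ n ih =>
    rw [im_aeval_mul_conj_succ hy]
    exact add_pos_of_nonneg_of_pos (mul_nonneg hz.le (Complex.normSq_nonneg _))
      (mul_pos (ha n) ih)

/-- The polynomials `p = P K`, `q` (second kind) and `G` in the periodic case, with `p² - G q`
constant and the positivity properties of `G / p` and `p / q`. -/
structure PellData (p q G : ℝ[X]) (c : ℝ) : Prop where
  pell : p ^ 2 - G * q = C c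
  pos : 0 < c
  deriv_div_pos : ∀ x, 0 < G.derivative.eval x * p.eval x - G.eval x * p.derivative.eval x
  deriv_div_ge : ∀ x, q.eval x ^ 2 ≤
    p.derivative.eval x * q.eval x - p.eval x * q.derivative.eval x
  im_pos : ∀ z : ℂ, 0 < z.im → 0 < (aeval z G * conj (aeval z p)).im
  im_ge : ∀ z : ℂ, 0 < z.im →
    z.im * Complex.normSq (aeval z q) ≤ (aeval z p * conj (aeval z q)).im

lemma IsRecurrence.pellData (hab : IsRecurrence P a b) (hP : IsMonicOrthogonal α β P)
    (h : IsBranchPoints α β) (hK : HasPeriod a b K) {S : ℝ[X]}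
    (hS : secondKind a b K = numer α * S)
    (hS1 : 2 * P (K + 1) = P K * P 1 + denom β * S)
    (hS2 : 2 * secondKind a b (K + 1) = P K + secondKind a b K * P 1) :
    PellData (P K) (secondKind a b K) (denom β * S) (2 * pairing α β (P K) (P K)) := by
  have hpell := hab.pell hP h hS hS1 hS2
  have hb := hK.b_periodic 1 le_rfl
  have ha := hab.a_pos hP h
  obtain ⟨k, rfl⟩ : ∃ k, K = k + 1 := ⟨K - 1, by have := hK.pos; omega⟩
  have hPy := hab.add_two
  have hQy := secondKind_add_two a b
  -- Since b_{K+1} = b₁, both G and P_K arise by one more recurrence step with `a (k + 1)` doubled,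
  -- from `P` and from the second kind polynomials respectively. The sign arguments therefore extend
  -- to them.
  have hG : denom β * S = (X - C (b 1)) * P (k + 1) - 2 * C (a (k + 1)) * P k := by
    have e := hPy k
    rw [show k + 2 = 1 + (k + 1) by ring, hb, show 1 + (k + 1) = k + 1 + 1 by ring] at e
    rw [e, hab.one_eq hP] at hS1
    linear_combination -hS1
  have hp : P (k + 1) = (X - C (b 1)) * secondKind a b (k + 1) -
      2 * C (a (k + 1)) * secondKind a b k := by
    have e := hQy k
    rw [show k + 2 = 1 + (k + 1) by ring, hb, show 1 + (k + 1) = k + 1 + 1 by ring] at e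
    rw [e, hab.one_eq hP] at hS2
    linear_combination -hS2
  have hak := ha k
  refine ⟨?_, ?_, ?_, ?_, ?_, ?_⟩
  · rw [← hpell, hS]
    ring
  · have := hP.pairing_pos h (k + 1)
    positivity
  · intro x
    have hw := eval_wronskian_pos hPy ha x (by simp [hab.one_eq hP, hP.eq_one]) k
    have e : (denom β * S).derivative.eval x * (P (k + 1)).eval x -
        (denom β * S).eval x * (P (k + 1)).derivative.eval x = (P (k + 1)).eval x ^ 2 +
        2 * a (k + 1) * ((P (k + 1)).derivative.eval x * (P k).eval x -
          (P (k + 1)).eval x * (P k).derivative.eval x) := by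
      rw [hG]
      simp only [derivative_sub, derivative_mul, derivative_X, derivative_C, derivative_ofNat,
        eval_sub, eval_add, eval_mul, eval_X, eval_C, eval_one, eval_zero, eval_ofNat]
      ring
    rw [e]
    positivity
  · intro x
    have hw := eval_wronskian_nonneg hQy ha x (by simp [secondKind_one, secondKind_zero]) k
    have e : (P (k + 1)).derivative.eval x * (secondKind a b (k + 1)).eval x -
        (P (k + 1)).eval x * (secondKind a b (k + 1)).derivative.eval x =
        (secondKind a b (k + 1)).eval x ^ 2 +
        2 * a (k + 1) * ((secondKind a b (k + 1)).derivative.eval x * (secondKind a b k).eval x -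
          (secondKind a b (k + 1)).eval x * (secondKind a b k).derivative.eval x) := by
      rw [hp]
      simp only [derivative_sub, derivative_mul, derivative_X, derivative_C, derivative_ofNat,
        eval_sub, eval_add, eval_mul, eval_X, eval_C, eval_one, eval_zero, eval_ofNat]
      ring
    rw [e]
    have := mul_nonneg (mul_nonneg zero_le_two hak.le) hw
    linarith
  · intro z hz
    have hw := im_aeval_mul_conj_pos hPy ha hz (by simp [hab.one_eq hP, hP.eq_one, hz]) k
    have e : (aeval z (denom β * S) * conj (aeval z (P (k + 1)))).im =
        z.im * Complex.normSq (aeval z (P (k + 1))) +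
          2 * a (k + 1) * (aeval z (P (k + 1)) * conj (aeval z (P k))).im := by
      rw [hG]
      simp only [map_sub, map_mul, map_ofNat, aeval_X, aeval_C, Complex.coe_algebraMap,
        Complex.mul_im, Complex.sub_re, Complex.sub_im, Complex.mul_re, Complex.ofReal_re,
        Complex.ofReal_im, Complex.conj_re, Complex.conj_im, Complex.normSq_apply,
        Complex.re_ofNat, Complex.im_ofNat]
      ring
    rw [e]
    have := Complex.normSq_nonneg (aeval z (P (k + 1)))
    positivity
  · intro z hz
    have hw := im_aeval_mul_conj_nonneg hQy ha hz (by simp [secondKind_one, secondKind_zero]) k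
    have e : (aeval z (P (k + 1)) * conj (aeval z (secondKind a b (k + 1)))).im =
        z.im * Complex.normSq (aeval z (secondKind a b (k + 1))) +
          2 * a (k + 1) *
            (aeval z (secondKind a b (k + 1)) * conj (aeval z (secondKind a b k))).im := by
      rw [hp]
      simp only [map_sub, map_mul, map_ofNat, aeval_X, aeval_C, Complex.coe_algebraMap,
        Complex.mul_im, Complex.sub_re, Complex.sub_im, Complex.mul_re, Complex.ofReal_re,
        Complex.ofReal_im, Complex.conj_re, Complex.conj_im, Complex.normSq_apply,
        Complex.re_ofNat, Complex.im_ofNat]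
      ring
    rw [e]
    have := mul_nonneg (mul_nonneg zero_le_two hak.le) hw
    linarith

/-! ### Consequences of Pell's equation combined with monotonicity. -/

namespace PellData

variable {p q G : ℝ[X]} {c : ℝ}

lemma eval_eq (d : PellData p q G c) (x : ℝ) : p.eval x ^ 2 - G.eval x * q.eval x = c := by
  have := congrArg (eval x) d.pell
  simpa using this

/-- At a critical point `p² ≥ c`. -/
lemma le_sq_of_critical (d : PellData p q G c) {x : ℝ} (hx : p.derivative.eval x = 0) :
    c ≤ p.eval x ^ 2 := by
  by_contra hcon
  have h1 := d.deriv_div_pos x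
  have h2 := d.deriv_div_ge x
  have h3 := d.eval_eq x
  have h4 : G.derivative.eval x * q.eval x + G.eval x * q.derivative.eval x = 0 := by
    have := congrArg (fun r : ℝ[X] => r.derivative.eval x) d.pell
    simp only [derivative_sub, derivative_pow, derivative_mul, derivative_C, eval_sub, eval_add,
      eval_mul, eval_zero, hx] at this
    linarith
  rw [hx] at h1 h2
  have h5 : G.eval x * q.eval x < 0 := by linarith
  have hq : 0 < q.eval x ^ 2 := by
    have : q.eval x ≠ 0 := right_ne_zero_of_mul h5.ne
    positivity
  have h6 : 0 < -(p.eval x * q.derivative.eval x) := by linarith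
  -- At a critical point (G q)' = 0. If p² < c then G q < 0, so this identity equates a positive
  -- number (G' p > 0) with a negative one (-p q' > 0).
  have h7 : (G.derivative.eval x * p.eval x) * q.eval x ^ 2 =
      (G.eval x * q.eval x) * -(p.eval x * q.derivative.eval x) := by
    linear_combination (p.eval x * q.eval x) * h4
  have h8 : 0 < (G.derivative.eval x * p.eval x) * q.eval x ^ 2 :=
    mul_pos (by linarith) hq
  have h9 := mul_neg_of_neg_of_pos h5 h6
  linarith

/-- Two zeros of `G` are separated by a zero of `p`. -/
lemma exists_root_between (d : PellData p q G c) {u v : ℝ} (huv : u < v) (hu : G.eval u = 0)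
    (hv : G.eval v = 0) : ∃ x ∈ Set.Icc u v, p.eval x = 0 := by
  by_contra! hcon
  have hd : ∀ x ∈ Set.Icc u v, HasDerivAt (fun x => G.eval x / p.eval x)
      ((G.derivative.eval x * p.eval x - G.eval x * p.derivative.eval x) / p.eval x ^ 2) x :=
    -- Without a zero of `p`, Rolle's theorem would apply to G / p, whose derivative is positive.
    fun x hx => (G.hasDerivAt x).fun_div (p.hasDerivAt x) (hcon x hx)
  obtain ⟨x, hx, hx0⟩ := exists_hasDerivAt_eq_zero huv
    (fun x hx => (hd x hx).continuousAt.continuousWithinAt) (by simp [hu, hv])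
    (fun x hx => hd x (Set.Ioo_subset_Icc_self hx))
  have h1 := d.deriv_div_pos x
  have h2 := hcon x (Set.Ioo_subset_Icc_self hx)
  have : 0 < p.eval x ^ 2 := by positivity
  exact (div_pos h1 this).ne' hx0

/-- Where `p` takes a real value `r` with `r² ≤ c` in the open upper half plane,
`q` vanishes and `G` does not. -/
lemma aeval_eq_zero_of_im_pos (d : PellData p q G c) {z : ℂ} (hz : 0 < z.im) {r : ℝ}
    (hr : aeval z p = (r : ℂ)) (hrc : r ^ 2 ≤ c) : aeval z q = 0 ∧ aeval z G ≠ 0 := by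
  have h1 := d.im_pos z hz
  have h2 := d.im_ge z hz
  have h3 : (r : ℂ) ^ 2 - aeval z G * aeval z q = (c : ℂ) := by
    have := congrArg (aeval z) d.pell
    simpa [hr] using this
  rw [hr] at h1 h2
  set w := aeval z G with hw
  set s := aeval z q with hs
  have hre := congrArg Complex.re h3
  have him := congrArg Complex.im h3
  rw [← Complex.ofReal_pow] at hre him
  simp only [Complex.sub_re, Complex.sub_im, Complex.mul_re, Complex.mul_im, Complex.ofReal_re,
    Complex.ofReal_im, Complex.conj_re, Complex.conj_im] at hre him h1 h2
  have hwim : w.im ≠ 0 := by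
    intro h0
    rw [h0] at h1
    simp at h1
  have hw2 : 0 < w.re ^ 2 + w.im ^ 2 := by positivity
  have hns := mul_nonneg hz.le (Complex.normSq_nonneg s)
  -- Here w s = r² - c is real and nonpositive, so Im s is a nonnegative multiple of Im w. As r Im w
  -- > 0, this forces r Im s ≥ 0, whereas `h2` bounds -r Im s below by z.im |s|².
  have key : (r * s.im) * (w.re ^ 2 + w.im ^ 2) = (c - r ^ 2) * (w.im * r) := by
    linear_combination (-r * w.re) * him + (r * w.im) * hre
  have h4 : 0 ≤ (r * s.im) * (w.re ^ 2 + w.im ^ 2) := by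
    rw [key]
    exact mul_nonneg (by linarith) (by linarith)
  have h5 : 0 ≤ r * s.im := nonneg_of_mul_nonneg_left h4 hw2
  have h6 : z.im * Complex.normSq s ≤ 0 := by linarith
  refine ⟨?_, fun h0 => hwim (by rw [h0, Complex.zero_im])⟩
  have h7 : z.im * Complex.normSq s = 0 := le_antisymm h6 hns
  exact Complex.normSq_eq_zero.mp ((mul_eq_zero.mp h7).resolve_left hz.ne')

end PellData

lemma aeval_numer_ne_zero (α : Fin g → ℝ) {z : ℂ} (hz : z.im ≠ 0) : aeval z (numer α) ≠ 0 := by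
  rw [numer, map_prod]
  refine Finset.prod_ne_zero_iff.mpr fun j _ h0 => hz ?_
  have := congrArg Complex.im h0
  simpa using this

/-- A nonreal point is never mapped into `[-√c, √c]`. -/
lemma PellData.im_eq_zero {p S : ℝ[X]} {c : ℝ}
    (d : PellData p (numer α * S) (denom β * S) c) {z : ℂ} {r : ℝ}
    (hr : aeval z p = (r : ℂ)) (hrc : r ^ 2 ≤ c) : z.im = 0 := by
  have key : ∀ z : ℂ, aeval z p = (r : ℂ) → ¬ 0 < z.im := by
    intro z hr hz
    -- The zero of A S at the nonreal `z` must come from S, contradicting B S ≠ 0.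
    obtain ⟨h1, h2⟩ := d.aeval_eq_zero_of_im_pos hz hr hrc
    rw [map_mul] at h1 h2
    exact h2 (by
      rw [(mul_eq_zero.mp h1).resolve_left (aeval_numer_ne_zero α hz.ne'), mul_zero])
  have h1 := key z hr
  have h2 := key (conj z) (by rw [aeval_conj, hr, Complex.conj_ofReal])
  rw [Complex.conj_im] at h2
  linarith

/-- `E` is the real preimage of `[-√c, √c]` under `p`. -/
lemma PellData.sq_le_iff {p S : ℝ[X]} {c : ℝ} (h : IsBranchPoints α β)
    (d : PellData p (numer α * S) (denom β * S) c) {x : ℝ} :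
    p.eval x ^ 2 ≤ c ↔ x ∈ E α β := by
  have he : ∀ x, p.eval x ^ 2 = c + (numer α).eval x * (denom β).eval x * S.eval x ^ 2 := by
    intro x
    have := d.eval_eq x
    simp only [eval_mul] at this
    linarith
  have hne : ∀ x, 0 ≤ (numer α).eval x * (denom β).eval x → p.eval x ≠ 0 := by
    intro x hx h0
    have h1 := he x
    have h2 := d.pos
    have h3 := mul_nonneg hx (sq_nonneg (S.eval x))
    rw [h0] at h1
    linarith
  constructor
  · intro hx
    by_contra hxE
    have hAB : (numer α).eval x * (denom β).eval x ≠ 0 := fun h0 =>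
      hxE (h.mem_E_of_numer_mul_denom_eq_zero h0)
    -- Outside E, p² ≤ c forces S(x) = 0, so G vanishes at x and also at an endpoint ±1 or β_j of
    -- the same complementary interval. Between them p would have a zero, but there p² ≥ c.
    have hS : 0 ≤ (numer α).eval x * (denom β).eval x → (denom β * S).eval x = 0 := by
      intro h0
      have h1 := he x
      have h2 : 0 < (numer α).eval x * (denom β).eval x := lt_of_le_of_ne h0 hAB.symm
      have h3 : S.eval x ^ 2 ≤ 0 := by
        by_contra hcon
        have := mul_pos h2 (not_le.mp hcon)
        linarith
      have h4 : S.eval x = 0 := pow_eq_zero_iff two_ne_zero |>.mp (le_antisymm h3 (sq_nonneg _))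
      rw [eval_mul, h4, mul_zero]
    have hend : ∀ y, (denom β).eval y = 0 → (denom β * S).eval y = 0 := by
      intro y hy
      rw [eval_mul, hy, zero_mul]
    rcases lt_or_ge 1 x with h1 | h1
    · obtain ⟨y, hy, hy0⟩ := d.exists_root_between h1 (hend 1 (by simp [eval_denom]))
        (hS (h.numer_mul_denom_nonneg_of_one_le h1.le))
      exact hne y (h.numer_mul_denom_nonneg_of_one_le hy.1) hy0
    rcases lt_or_ge x (-1) with h2 | h2
    · obtain ⟨y, hy, hy0⟩ := d.exists_root_between h2
        (hS (h.numer_mul_denom_nonneg_of_le_neg_one h2.le)) (hend (-1) (by simp [eval_denom]))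
      exact hne y (h.numer_mul_denom_nonneg_of_le_neg_one hy.2) hy0
    · obtain ⟨j, hj⟩ := IsBranchPoints.exists_gap hxE h2 h1
      have hb : (denom β).eval (β j) = 0 := by
        rw [← bandLeft_succ β j]
        exact denom_bandLeft β _
      obtain ⟨y, hy, hy0⟩ := d.exists_root_between hj.2
        (hS (h.numer_mul_denom_nonneg_of_gap ⟨hj.1.le, hj.2.le⟩)) (hend _ hb)
      exact hne y (h.numer_mul_denom_nonneg_of_gap ⟨hj.1.le.trans hy.1, hy.2⟩) hy0
  · intro hx
    rw [he x]
    have := mul_nonpos_of_nonpos_of_nonneg (h.numer_mul_denom_nonpos hx) (sq_nonneg (S.eval x))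
    linarith

/-- A polynomial with `m² = 1` at the endpoints of an interval, `m² ≤ 1` inside and without
critical values in `(-1, 1)` takes the value `-1`. -/
lemma exists_eval_eq_neg_one {m : ℝ[X]} (hm : 0 < m.natDegree) {l r : ℝ} (hlr : l < r)
    (hl : m.eval l ^ 2 = 1) (hr : m.eval r ^ 2 = 1)
    (hle : ∀ x ∈ Set.Icc l r, m.eval x ^ 2 ≤ 1)
    (hcrit : ∀ x, m.derivative.eval x = 0 → 1 ≤ m.eval x ^ 2) :
    ∃ x ∈ Set.Icc l r, m.eval x = -1 := by
  by_contra! hcon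
  have hone : ∀ x ∈ Set.Icc l r, m.eval x ^ 2 = 1 → m.eval x = 1 := fun x hx h1 => by
    have h2 : (m.eval x - 1) * (m.eval x + 1) = 0 := by linarith
    rcases mul_eq_zero.mp h2 with h3 | h3
    · exact sub_eq_zero.mp h3
    · exact absurd (eq_neg_of_add_eq_zero_left h3) (hcon x hx)
  have hl1 : m.eval l = 1 := hone l ⟨le_rfl, hlr.le⟩ hl
  have hr1 : m.eval r = 1 := hone r ⟨hlr.le, le_rfl⟩ hr
  obtain ⟨x, hx, hmin⟩ := isCompact_Icc.exists_isMinOn (Set.nonempty_Icc.mpr hlr.le)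
    (f := fun x => m.eval x) (by fun_prop)
  have hx1 : m.eval x ≠ 1 := by
    intro h1
    have hall : ∀ y ∈ Set.Icc l r, m.eval y = (1 : ℝ[X]).eval y := by
      intro y hy
      have h2 : m.eval x ≤ m.eval y := hmin hy
      have h3 := hle y hy
      rw [eval_one]
      nlinarith
    have : m = 1 := eq_of_infinite_eval_eq m 1
      ((Set.Icc_infinite hlr).mono hall)
    rw [this, natDegree_one] at hm
    exact lt_irrefl _ hm
  have hxl : x ≠ l := fun e => hx1 (e ▸ hl1)
  have hxr : x ≠ r := fun e => hx1 (e ▸ hr1)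
  have hxI : x ∈ Set.Ioo l r := ⟨lt_of_le_of_ne hx.1 hxl.symm, lt_of_le_of_ne hx.2 hxr⟩
  -- Never reaching -1, `m` equals 1 at both ends and is not constant, so its minimum is an interior
  -- critical point; there m² = 1, hence m = 1 after all.
  have hloc : IsLocalMin (fun x => m.eval x) x := hmin.isLocalMin (Icc_mem_nhds hxI.1 hxI.2)
  have h0 := hcrit x (hloc.hasDerivAt_eq_zero (m.hasDerivAt x))
  have h1 : m.eval x ^ 2 = 1 := le_antisymm (hle x hx) h0
  exact hx1 (hone x hx h1)

end GenChebyshev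
end

/-! ### Normalization and Chebyshev polynomials of the first and second kind. -/

noncomputable section
namespace GenChebyshev

variable {g : ℕ} {α β : Fin g → ℝ} {P : ℕ → ℝ[X]} {a b : ℕ → ℝ} {K : ℕ}

lemma IsMonicOrthogonal.Delta_pos (hP : IsMonicOrthogonal α β P) (h : IsBranchPoints α β)
    (n : ℕ) : 0 < Delta α β P n :=
  Real.sqrt_pos.mpr (mul_pos two_pos (hP.pairing_pos h n))

lemma IsMonicOrthogonal.Delta_sq (hP : IsMonicOrthogonal α β P) (h : IsBranchPoints α β)
    (n : ℕ) : Delta α β P n ^ 2 = 2 * pairing α β (P n) (P n) :=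
  Real.sq_sqrt (mul_pos two_pos (hP.pairing_pos h n)).le

lemma monicT_zero : monicT 0 = 1 := by
  simp [monicT]

lemma monicT_succ (n : ℕ) :
    monicT (n + 1) = C ((2 : ℝ) ^ n)⁻¹ * Chebyshev.T ℝ ((n : ℤ) + 1) := by
  rw [monicT, Chebyshev.leadingCoeff_T, Int.natAbs_natCast, Nat.add_sub_cancel, Nat.cast_succ]

/-- `P` and the polynomials of the second kind at multiples of the period are Chebyshev
polynomials in the normalized `P K`. -/
lemma IsRecurrence.mul_period (hab : IsRecurrence P a b) (hP : IsMonicOrthogonal α β P)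
    (h : IsBranchPoints α β) (hK : HasPeriod a b K) (n : ℕ) :
    P ((n + 1) * K) = C (Delta α β P K ^ (n + 1) * ((2 : ℝ) ^ n)⁻¹) *
        (Chebyshev.T ℝ ((n : ℤ) + 1)).comp (normalized α β P K) ∧
      secondKind a b ((n + 1) * K) = C (Delta α β P K ^ n * ((2 : ℝ) ^ n)⁻¹) *
        (secondKind a b K * (Chebyshev.U ℝ (n : ℤ)).comp (normalized α β P K)) := by
  obtain ⟨S, hS, hS1, hS2⟩ := hab.exists_cofactor hP h hK
  have hpell := hab.pell hP h hS hS1 hS2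
  have hΔ := hP.Delta_pos h K
  set D := Delta α β P K with hD
  set M := normalized α β P K with hM
  have hPM : P K = C D * M := by
    rw [hM, normalized, ← mul_assoc, ← C_mul, ← hD, mul_inv_cancel₀ hΔ.ne', C_1, one_mul]
  -- Pell's equation in normalized form; it turns the addition formulas into T_{n+2} = X T_{n+1} -
  -- (1 - X²) U_n and U_{n+1} = X U_n + T_{n+1}, evaluated at M.
  have hGQ : denom β * S * secondKind a b K = C D ^ 2 * (M ^ 2 - 1) := by
    rw [← hP.Delta_sq h K, ← hD, hPM, C_pow] at hpell
    linear_combination -hpell + denom β * S * hS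
  induction n with
  | zero => simp [hPM]
  | succ n ih =>
    obtain ⟨m, hm⟩ : ∃ m, (n + 1) * K = m + 1 :=
      ⟨_, (Nat.succ_pred_eq_of_pos (Nat.mul_pos (Nat.succ_pos n) hK.pos)).symm⟩
    obtain ⟨e1, e2⟩ := hab.add_period hP h hK hS1 hS2 m
    have hidx : (n + 1 + 1) * K = m + 1 + K := by rw [← hm]; ring
    rw [hm] at ih
    rw [ih.1, ih.2] at e1 e2
    have hT := congrArg (fun r : ℝ[X] => r.comp M) (Chebyshev.T_eq_X_mul_T_sub_pol_U ℝ (n : ℤ))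
    have hU := congrArg (fun r : ℝ[X] => r.comp M) (Chebyshev.U_eq_X_mul_U_add_T ℝ (n : ℤ))
    simp only [sub_comp, mul_comp, add_comp, X_comp, pow_comp, one_comp] at hT hU
    have h2 : (2 : ℝ[X]) ≠ 0 := two_ne_zero
    have hc : (2 : ℝ[X]) * C ((2 : ℝ) ^ (n + 1))⁻¹ = C ((2 : ℝ) ^ n)⁻¹ := by
      have : (2 : ℝ[X]) = C 2 := by simp only [map_ofNat]
      rw [this, ← C_mul]
      congr 1
      rw [pow_succ]
      field_simp
    have hcast : ((n + 1 : ℕ) : ℤ) + 1 = (n : ℤ) + 2 := by push_cast; ring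
    rw [hidx, hcast, Nat.cast_succ, hT, hU]
    constructor
    · refine mul_left_cancel₀ h2 ?_
      rw [e1, hPM, C_mul, C_mul, C_mul, C_pow, C_pow, C_pow]
      linear_combination C D ^ n * C ((2 : ℝ) ^ n)⁻¹ *
        (Chebyshev.U ℝ (n : ℤ)).comp M * hGQ -
        C D ^ (n + 2) * (M * (Chebyshev.T ℝ ((n : ℤ) + 1)).comp M -
          (1 - M ^ 2) * (Chebyshev.U ℝ (n : ℤ)).comp M) * hc
    · refine mul_left_cancel₀ h2 ?_
      rw [e2, hPM, C_mul, C_mul, C_mul, C_pow, C_pow]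
      linear_combination -C D ^ (n + 1) * (secondKind a b K *
        (M * (Chebyshev.U ℝ (n : ℤ)).comp M + (Chebyshev.T ℝ ((n : ℤ) + 1)).comp M)) * hc

lemma IsRecurrence.monicT_comp (hab : IsRecurrence P a b) (hP : IsMonicOrthogonal α β P)
    (h : IsBranchPoints α β) (hK : HasPeriod a b K) (n : ℕ) :
    (monicT n).comp (normalized α β P K) = C (Delta α β P K ^ n)⁻¹ * P (n * K) := by
  cases n with
  | zero => simp [monicT_zero, hP.eq_one]
  | succ n =>
    have hΔ := (hP.Delta_pos h K).ne'
    rw [(hab.mul_period hP h hK n).1, monicT_succ, mul_comp, C_comp, ← mul_assoc, ← C_mul,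
      inv_mul_cancel_left₀ (pow_ne_zero _ hΔ)]

lemma eval_normalized (P : ℕ → ℝ[X]) (n : ℕ) (x : ℝ) :
    (normalized α β P n).eval x = (Delta α β P n)⁻¹ * (P n).eval x := by
  simp [normalized]

lemma IsMonicOrthogonal.eval_normalized_sq (hP : IsMonicOrthogonal α β P)
    (h : IsBranchPoints α β) (n : ℕ) (x : ℝ) :
    (normalized α β P n).eval x ^ 2 =
      (P n).eval x ^ 2 / (2 * pairing α β (P n) (P n)) := by
  rw [eval_normalized, mul_pow, inv_pow, hP.Delta_sq h, mul_comm, div_eq_mul_inv]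

end GenChebyshev
end

/-! ### The main theorem. -/

open GenChebyshev in
theorem theorem4p1 {g : ℕ} (α β : Fin g → ℝ) (hE : GenChebyshev.IsBranchPoints α β)
    (P : ℕ → Polynomial ℝ) (hP : GenChebyshev.IsMonicOrthogonal α β P)
    (a b : ℕ → ℝ) (hab : GenChebyshev.IsRecurrence P a b)
    (K : ℕ) (hK : GenChebyshev.HasPeriod a b K) :
    0 < GenChebyshev.Delta α β P K ∧
    (∀ k : Fin (g + 1),
      (fun x : ℝ => (GenChebyshev.normalized α β P K).eval x) '' GenChebyshev.band α β k =
        Set.Icc (-1) 1) ∧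
    (fun x : ℝ => (GenChebyshev.normalized α β P K).eval x) ⁻¹' Set.Icc (-1) 1 =
      GenChebyshev.E α β ∧
    (fun z : ℂ => Polynomial.aeval z (GenChebyshev.normalized α β P K)) ⁻¹'
        ((fun t : ℝ => (t : ℂ)) '' Set.Icc (-1) 1) =
      (fun x : ℝ => (x : ℂ)) '' GenChebyshev.E α β ∧
    (∀ n : ℕ, (GenChebyshev.monicT n).comp (GenChebyshev.normalized α β P K) =
      Polynomial.C (GenChebyshev.Delta α β P K ^ n)⁻¹ * P (n * K)) ∧
    g + 1 ≤ K := by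
  obtain ⟨S, hS, hS1, hS2⟩ := hab.exists_cofactor hP hE hK
  have d := hab.pellData hP hE hK hS hS1 hS2
  rw [hS] at d
  have hc := d.pos
  have hΔ := hP.Delta_pos hE K
  have hsq := hP.eval_normalized_sq hE K
  have hmem : ∀ x : ℝ, (normalized α β P K).eval x ∈ Set.Icc (-1 : ℝ) 1 ↔ x ∈ E α β := by
    intro x
    rw [← d.sq_le_iff hE, Set.mem_Icc, ← abs_le, ← sq_le_one_iff_abs_le_one, hsq,
      div_le_one hc]
  have hderiv : ∀ x : ℝ, (normalized α β P K).derivative.eval x = 0 →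
      1 ≤ (normalized α β P K).eval x ^ 2 := by
    intro x hx
    rw [hsq, one_le_div hc]
    refine d.le_sq_of_critical ?_
    rw [normalized, derivative_C_mul, eval_mul, eval_C] at hx
    exact (mul_eq_zero.mp hx).resolve_left (inv_ne_zero hΔ.ne')
  have hdeg : 0 < (normalized α β P K).natDegree := by
    rw [normalized, natDegree_C_mul (inv_ne_zero hΔ.ne'), hP.natDegree_eq]
    exact hK.pos
  have hend : ∀ x : ℝ, (numer α).eval x * (denom β).eval x = 0 →
      (normalized α β P K).eval x ^ 2 = 1 := by
    intro x hx
    rw [hsq, div_eq_one_iff_eq hc.ne']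
    have := d.eval_eq x
    simp only [eval_mul] at this
    linear_combination this + S.eval x ^ 2 * hx
  refine ⟨hΔ, fun k => ?_, ?_, ?_, hab.monicT_comp hP hE hK, ?_⟩
  · have hband : ∀ x ∈ Set.Icc (bandLeft β k) (bandRight α k),
        (normalized α β P K).eval x ∈ Set.Icc (-1 : ℝ) 1 := fun x hx =>
      (hmem x).mpr (Set.mem_iUnion.mpr ⟨k, hx⟩)
    have hband2 : ∀ x ∈ Set.Icc (bandLeft β k) (bandRight α k),
        (normalized α β P K).eval x ^ 2 ≤ 1 := fun x hx =>
      (sq_le_one_iff_abs_le_one _).mpr (abs_le.mpr (hband x hx))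
    have hl := hend (bandLeft β k) (by rw [denom_bandLeft, mul_zero])
    have hr := hend (bandRight α k) (numer_mul_denom_bandRight α β k)
    refine Set.Subset.antisymm ?_ ?_
    · rintro _ ⟨x, hx, rfl⟩
      exact hband x hx
    · obtain ⟨x, hx, hx1⟩ := exists_eval_eq_neg_one hdeg (hE.band k) hl hr hband2 hderiv
      obtain ⟨y, hy, hy1⟩ := exists_eval_eq_neg_one (m := -normalized α β P K)
        (by rwa [natDegree_neg]) (hE.band k) (by simpa using hl) (by simpa using hr)
        (by simpa using hband2) (by simpa using hderiv)
      rw [eval_neg, neg_inj] at hy1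
      have hconn : IsPreconnected ((fun x : ℝ => (normalized α β P K).eval x) ''
          Set.Icc (bandLeft β k) (bandRight α k)) :=
        isPreconnected_Icc.image _ (by fun_prop)
      exact hconn.Icc_subset ⟨x, hx, hx1⟩ ⟨y, hy, hy1⟩
  · ext x
    exact hmem x
  · ext z
    constructor
    · rintro ⟨t, ht, htz⟩
      change (t : ℂ) = aeval z (normalized α β P K) at htz
      have hp : aeval z (P K) = ((Delta α β P K * t : ℝ) : ℂ) := by
        have e : P K = C (Delta α β P K) * normalized α β P K := by
          rw [normalized, ← mul_assoc, ← C_mul, mul_inv_cancel₀ hΔ.ne', C_1, one_mul]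
        rw [e, map_mul, aeval_C, Complex.ofReal_mul, htz]
        rfl
      have hz : z.im = 0 := d.im_eq_zero hp (by
        rw [mul_pow, hP.Delta_sq hE]
        exact mul_le_of_le_one_right hc.le
          ((sq_le_one_iff_abs_le_one _).mpr (abs_le.mpr ht)))
      obtain ⟨x, rfl⟩ : ∃ x : ℝ, (x : ℂ) = z := ⟨z.re, Complex.ext rfl hz.symm⟩
      refine ⟨x, ?_, rfl⟩
      rw [← hmem x]
      have e : aeval (x : ℂ) (normalized α β P K) = (((normalized α β P K).eval x : ℝ) : ℂ) :=
        aeval_algebraMap_apply_eq_algebraMap_eval x _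
      have h2 : (t : ℂ) = (((normalized α β P K).eval x : ℝ) : ℂ) := htz.trans e
      rw [← Complex.ofReal_injective h2]
      exact ht
    · rintro ⟨x, hx, rfl⟩
      exact ⟨_, (hmem x).mpr hx,
        (aeval_algebraMap_apply_eq_algebraMap_eval x (normalized α β P K)).symm⟩
  -- A has degree g and divides the nonzero polynomial Q_K of degree K - 1.
  · obtain ⟨k, rfl⟩ : ∃ k, K = k + 1 := ⟨K - 1, by have := hK.pos; omega⟩
    obtain ⟨hQm, hQd⟩ := monic_natDegree_secondKind a b k
    have := natDegree_le_of_dvd (Dvd.intro S hS.symm) hQm.ne_zero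
    rw [natDegree_numer, hQd] at this
    omega
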